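/- A metrized graph $\Gamma$ is a finite connected graph whose edges are parametrized as closed segments $[0,L_e]$ of positive length (multiple edges and self-loops are allowed); points of $\Gamma$ may lie on vertices or in the interior of edges. For a function $f$ on $\Gamma$ that is continuous, $C^2$ off some finite vertex set, and has integrable second derivative, the Laplacian is the measure $$\Delta f=-f''(x)\,dx-\sum_{v\in\Gamma}\Big(\sum_{\vec d\text{ at }v}d_{\vec d}f(v)\Big)\delta_v ,$$ where the inner sum runs over the outgoing directional derivatives at $v$. The voltage function $j_z(x,y)$ is, as a function of $x$, the solution of $\Delta_x\, j_z(x,y)=\delta_y(x)-\delta_z(x)$ with $j_z(z,y)=0$; the resistance function is $r(x,y)=j_x(y,y)$. For $p,q\in\Gamma$ put $$A_{p,q,\Gamma}=\int_\Gamma j_x(p,q)\Big(\frac{d}{dx}j_p(x,q)\Big)^2dx .$$ **Theorem.** (a) Let $\Gamma_1\cup\Gamma_2$ denote the union, along two distinct points $p$ and $q$, of two metrized graphs $\Gamma_1$ and $\Gamma_2$, so that $\Gamma_1\cap\Gamma_2=\{p,q\}$ (that is, two distinct points of $\Gamma_1$ are identified with two distinct points of $\Gamma_2$). Let $r_1(x,y)$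 and $r_2(x,y)$ be the resistance functions on $\Gamma_1$ and $\Gamma_2$, respectively. Then $$A_{p,q,\Gamma_1\cup\Gamma_2}=\frac{r_2(p,q)^2A_{p,q,\Gamma_1}+r_1(p,q)^2A_{p,q,\Gamma_2}}{\big(r_1(p,q)+r_2(p,q)\big)^2}+\frac16\Big(\frac{r_1(p,q)\,r_2(p,q)}{r_1(p,q)+r_2(p,q)}\Big)^2 .$$ (b) Let $\Gamma$ be a circle graph of total length $a+b$, and let $p,q\in\Gamma$ be such that the two arcs connecting $p$ and $q$ have lengths $a>0$ and $b>0$. Then $A_{p,q,\Gamma}=\dfrac{a^2b^2}{6(a+b)^2}$. (c) Let $m\ge 1$ and let $\Gamma$ be an $m$-banana graph, i.e. the graph with two vertices $p,q$ joined by $m$ edges of arbitrary positive lengths, and let $r$ be its resistance function. Then $A_{p,q,\Gamma}=(m-1)\,\dfrac{r(p,q)^2}{6}$. -/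

import Mathlib

open Set MeasureTheory

noncomputable section

/-- A metrized graph with point set `X`: a finite, connected collection of closed line segments
`[0, len e]`, `e : E`, each with a distinguished parametrization `param e` onto its image in `X`,
covering `X` and glued to one another (or to themselves, so loops and multiple segments are allowed)
at only finitely many points. Gluing may take place at end points and at interior points of the
segments, so no vertex set is part of the data; see `IsVertexSet`.
Only the values of `param e` on `[0, len e]` matter. -/
structure MetrizedGraph (X E : Type*) [Fintype E] where
  len : E → ℝ
  len_pos : ∀ e, 0 < len e
  param : E → ℝ → X
  covers : ∀ x, ∃ e, ∃ t ∈ Icc 0 (len e), param e t = x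
  finite_glued : {a : E × ℝ | a.2 ∈ Icc 0 (len a.1) ∧
    ∃ b : E × ℝ, b ≠ a ∧ b.2 ∈ Icc 0 (len b.1) ∧ param b.1 b.2 = param a.1 a.2}.Finite
  nonempty : Nonempty X
  /-- Any two points are joined by a finite chain of segments. -/
  connected : ∀ x y, Relation.ReflTransGen
    (fun x y => ∃ e, ∃ s ∈ Icc 0 (len e), ∃ t ∈ Icc 0 (len e), param e s = x ∧ param e t = y) x y

namespace MetrizedGraph

variable {X E : Type*} [Fintype E] (Γ : MetrizedGraph X E)

/-- The positions `(e, t)` on the segments that represent the point `x`. -/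
def fiber (x : X) : Set (E × ℝ) := {a | a.2 ∈ Icc 0 (Γ.len a.1) ∧ Γ.param a.1 a.2 = x}

/-- A vertex set: a finite set of points such that every other point is an interior point of exactly
one segment, at exactly one position. It may always be enlarged. -/
def IsVertexSet (V : Set X) : Prop :=
  V.Finite ∧ ∀ x, x ∉ V → ∃ a : E × ℝ, a.2 ∈ Ioo 0 (Γ.len a.1) ∧ Γ.fiber x = {a}

/-- The (real-valued) functions in `Zh(Γ)`: continuous on `Γ` (for the quotient topology) and, for
some vertex set `V`, of class `C²` off `V`, with integrable second derivative. -/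
def Zh (f : X → ℝ) : Prop :=
  (∀ e, ContinuousOn (fun t => f (Γ.param e t)) (Icc 0 (Γ.len e))) ∧
  (∃ V : Set X, Γ.IsVertexSet V ∧ ∀ e,
    ContDiffOn ℝ 2 (fun t => f (Γ.param e t)) {t ∈ Ioo 0 (Γ.len e) | Γ.param e t ∉ V}) ∧
  ∀ e, IntegrableOn (deriv (deriv (fun t => f (Γ.param e t)))) (Icc 0 (Γ.len e))

/-- The sum of the derivatives of `f` at `x` in all the directions emanating from `x`. A position
`(e, t)` over `x` contributes the forward direction (if `t < len e`) and the backward direction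
(if `0 < t`); `derivWithin` on a one-point interval is `0`, so that a missing direction
contributes `0`. -/
def slopeSum (f : X → ℝ) (x : X) : ℝ :=
  ∑ᶠ a ∈ Γ.fiber x,
    (derivWithin (fun t => f (Γ.param a.1 t)) (Icc a.2 (Γ.len a.1)) a.2
      - derivWithin (fun t => f (Γ.param a.1 t)) (Icc 0 a.2) a.2)

/-- The absolutely continuous part of the Laplacian `Δf`: its density `-f''` with respect to
arc length, on the segment `e`. -/
def laplacianDensity (f : X → ℝ) (e : E) (t : ℝ) : ℝ :=
  -deriv (deriv (fun s => f (Γ.param e s))) t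

/-- The discrete part of the Laplacian `Δf`: the mass of `Δf` at the point `x`. -/
def laplacianAtom (f : X → ℝ) (x : X) : ℝ := -Γ.slopeSum f x

/-- `f` lies in `Zh(Γ)` and `Δf = δ_y - δ_z` as measures: the density of `Δf` vanishes almost
everywhere and the point masses are those of `δ_y - δ_z`. -/
def LaplacianEqDiracSub (f : X → ℝ) (y z : X) : Prop :=
  Γ.Zh f ∧
  (∀ e, ∀ᵐ t ∂(volume.restrict (Icc 0 (Γ.len e))), Γ.laplacianDensity f e t = 0) ∧
  ∀ x, Γ.laplacianAtom f x = ({y} : Set X).indicator 1 x - ({z} : Set X).indicator 1 x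

open Classical in
/-- The voltage function `j_z(x, y)`: as a function of `x`, the solution of
`Δ_x j_z(x, y) = δ_y - δ_z` with `j_z(z, y) = 0`. -/
def voltage (z x y : X) : ℝ :=
  if h : ∃ f : X → ℝ, Γ.LaplacianEqDiracSub f y z ∧ f z = 0 then h.choose x else 0

/-- The resistance function `r(x, y) = j_x(y, y)`. -/
def resistance (x y : X) : ℝ := Γ.voltage x y y

/-- `A_{p,q,Γ} = ∫_Γ j_x(p, q) (d/dx j_p(x, q))² dx`. -/
def A (p q : X) : ℝ :=
  ∑ e, ∫ t in (0 : ℝ)..Γ.len e,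
    Γ.voltage (Γ.param e t) p q * (deriv (fun s => Γ.voltage p (Γ.param e s) q) t) ^ 2

theorem fiber_finite (x : X) : (Γ.fiber x).Finite := by
  by_cases h : (Γ.fiber x).Subsingleton
  · exact h.finite
  · refine Γ.finite_glued.subset fun a ha => ?_
    rw [Set.not_subsingleton_iff] at h
    obtain ⟨b, hb, hne⟩ := h.exists_ne a
    exact ⟨ha.1, b, hne, hb.1, hb.2.trans ha.2.symm⟩

end MetrizedGraph

section Glue

variable {X₁ X₂ : Type*}

/-- The identifications `p₁ = p₂` and `q₁ = q₂` on the disjoint union of `X₁` and `X₂`. -/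
inductive GlueRel (p₁ q₁ : X₁) (p₂ q₂ : X₂) : X₁ ⊕ X₂ → X₁ ⊕ X₂ → Prop
  | left : GlueRel p₁ q₁ p₂ q₂ (Sum.inl p₁) (Sum.inr p₂)
  | right : GlueRel p₁ q₁ p₂ q₂ (Sum.inl q₁) (Sum.inr q₂)

/-- The disjoint union of `X₁` and `X₂` with `p₁`, `p₂` identified and `q₁`, `q₂` identified. -/
def Glue (p₁ q₁ : X₁) (p₂ q₂ : X₂) := Quot (GlueRel p₁ q₁ p₂ q₂)

/-- The map from `X₁` to the glued space. -/
def Glue.inl (p₁ q₁ : X₁) (p₂ q₂ : X₂) (x : X₁) : Glue p₁ q₁ p₂ q₂ := Quot.mk _ (Sum.inl x)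

/-- The map from `X₂` to the glued space. -/
def Glue.inr (p₁ q₁ : X₁) (p₂ q₂ : X₂) (x : X₂) : Glue p₁ q₁ p₂ q₂ := Quot.mk _ (Sum.inr x)

theorem Glue.eq_or {p₁ q₁ : X₁} {p₂ q₂ : X₂} {a b : X₁ ⊕ X₂}
    (h : Quot.mk (GlueRel p₁ q₁ p₂ q₂) a = Quot.mk (GlueRel p₁ q₁ p₂ q₂) b) :
    a = b ∨ (a ∈ ({Sum.inl p₁, Sum.inl q₁, Sum.inr p₂, Sum.inr q₂} : Set (X₁ ⊕ X₂)) ∧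
      b ∈ ({Sum.inl p₁, Sum.inl q₁, Sum.inr p₂, Sum.inr q₂} : Set (X₁ ⊕ X₂))) := by
  have h' := Quot.eqvGen_exact h
  clear h
  induction h' with
  | rel x y h => cases h <;> simp
  | refl x => exact Or.inl rfl
  | symm x y _ ih =>
    rcases ih with h | h
    · exact Or.inl h.symm
    · exact Or.inr h.symm
  | trans x y z _ _ ih1 ih2 =>
    rcases ih1 with rfl | h1
    · exact ih2
    · rcases ih2 with rfl | h2
      · exact Or.inr h1
      · exact Or.inr ⟨h1.1, h2.2⟩

variable {E₁ E₂ : Type*} [Fintype E₁] [Fintype E₂]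

/-- The union of two metrized graphs along two points: the point `p₁` of `Γ₁` is identified with the
point `p₂` of `Γ₂`, and `q₁` with `q₂`. -/
def MetrizedGraph.glue (Γ₁ : MetrizedGraph X₁ E₁) (Γ₂ : MetrizedGraph X₂ E₂)
    (p₁ q₁ : X₁) (p₂ q₂ : X₂) : MetrizedGraph (Glue p₁ q₁ p₂ q₂) (E₁ ⊕ E₂) where
  len := Sum.elim Γ₁.len Γ₂.len
  len_pos := by
    rintro (e | e)
    · exact Γ₁.len_pos e
    · exact Γ₂.len_pos e
  param := Sum.elim (fun e t => Glue.inl p₁ q₁ p₂ q₂ (Γ₁.param e t))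
    (fun e t => Glue.inr p₁ q₁ p₂ q₂ (Γ₂.param e t))
  covers := by
    rintro ⟨x | x⟩
    · obtain ⟨e, t, ht, rfl⟩ := Γ₁.covers x
      exact ⟨Sum.inl e, t, ht, rfl⟩
    · obtain ⟨e, t, ht, rfl⟩ := Γ₂.covers x
      exact ⟨Sum.inr e, t, ht, rfl⟩
  finite_glued := by
    refine ((((Γ₁.finite_glued.union (Γ₁.fiber_finite p₁)).union (Γ₁.fiber_finite q₁)).image
      (fun a => ((Sum.inl a.1 : E₁ ⊕ E₂), a.2))).union
      (((Γ₂.finite_glued.union (Γ₂.fiber_finite p₂)).union (Γ₂.fiber_finite q₂)).image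
      (fun a => ((Sum.inr a.1 : E₁ ⊕ E₂), a.2)))).subset ?_
    rintro ⟨e | e, t⟩ ⟨ht, ⟨e' | e', t'⟩, hne, ht', h⟩
    · left
      refine ⟨(e, t), ?_, rfl⟩
      rcases Glue.eq_or h with h | ⟨-, h⟩
      · exact Or.inl (Or.inl ⟨ht, (e', t'), by simpa using hne, ht', by simpa using h⟩)
      · simp only [mem_insert_iff, Sum.inl.injEq, mem_singleton_iff, reduceCtorEq, or_false] at h
        rcases h with h | h
        · exact Or.inl (Or.inr ⟨ht, h⟩)
        · exact Or.inr ⟨ht, h⟩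
    · left
      refine ⟨(e, t), ?_, rfl⟩
      rcases Glue.eq_or h with h | ⟨-, h⟩
      · simp at h
      · simp only [mem_insert_iff, Sum.inl.injEq, mem_singleton_iff, reduceCtorEq, or_false] at h
        rcases h with h | h
        · exact Or.inl (Or.inr ⟨ht, h⟩)
        · exact Or.inr ⟨ht, h⟩
    · right
      refine ⟨(e, t), ?_, rfl⟩
      rcases Glue.eq_or h with h | ⟨-, h⟩
      · simp at h
      · simp only [mem_insert_iff, Sum.inr.injEq, mem_singleton_iff, reduceCtorEq, false_or] at h
        rcases h with h | h
        · exact Or.inl (Or.inr ⟨ht, h⟩)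
        · exact Or.inr ⟨ht, h⟩
    · right
      refine ⟨(e, t), ?_, rfl⟩
      rcases Glue.eq_or h with h | ⟨-, h⟩
      · exact Or.inl (Or.inl ⟨ht, (e', t'), by simpa using hne, ht', by simpa using h⟩)
      · simp only [mem_insert_iff, Sum.inr.injEq, mem_singleton_iff, reduceCtorEq, false_or] at h
        rcases h with h | h
        · exact Or.inl (Or.inr ⟨ht, h⟩)
        · exact Or.inr ⟨ht, h⟩
  nonempty := ⟨Glue.inl p₁ q₁ p₂ q₂ p₁⟩
  connected := by
    set R := fun x y : Glue p₁ q₁ p₂ q₂ => ∃ e : E₁ ⊕ E₂,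
      ∃ s ∈ Icc 0 (Sum.elim Γ₁.len Γ₂.len e), ∃ t ∈ Icc 0 (Sum.elim Γ₁.len Γ₂.len e),
        (Sum.elim (fun e t => Glue.inl p₁ q₁ p₂ q₂ (Γ₁.param e t))
          (fun e t => Glue.inr p₁ q₁ p₂ q₂ (Γ₂.param e t)) e : ℝ → Glue p₁ q₁ p₂ q₂) s = x ∧
        (Sum.elim (fun e t => Glue.inl p₁ q₁ p₂ q₂ (Γ₁.param e t))
          (fun e t => Glue.inr p₁ q₁ p₂ q₂ (Γ₂.param e t)) e : ℝ → Glue p₁ q₁ p₂ q₂) t = y with hR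
    have h1 : ∀ x y, Relation.ReflTransGen R (Glue.inl p₁ q₁ p₂ q₂ x) (Glue.inl p₁ q₁ p₂ q₂ y) :=
      fun x y => (Γ₁.connected x y).lift _ (by
        rintro _ _ ⟨e, s, hs, t, ht, rfl, rfl⟩
        exact ⟨Sum.inl e, s, hs, t, ht, rfl, rfl⟩)
    have h2 : ∀ x y, Relation.ReflTransGen R (Glue.inr p₁ q₁ p₂ q₂ x) (Glue.inr p₁ q₁ p₂ q₂ y) :=
      fun x y => (Γ₂.connected x y).lift _ (by
        rintro _ _ ⟨e, s, hs, t, ht, rfl, rfl⟩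
        exact ⟨Sum.inr e, s, hs, t, ht, rfl, rfl⟩)
    have hp : Glue.inl p₁ q₁ p₂ q₂ p₁ = Glue.inr p₁ q₁ p₂ q₂ p₂ := Quot.sound GlueRel.left
    rintro ⟨x | x⟩ ⟨y | y⟩
    · exact h1 x y
    · exact (h1 x p₁).trans (hp ▸ h2 p₂ y)
    · exact (h2 x p₂).trans (hp ▸ h1 p₁ y)
    · exact h2 x y

end Glue

/-- The circle graph of total length `ℓ`: one segment `[0, ℓ]` with its end points identified. -/
def circleGraph (ℓ : ℝ) (hℓ : 0 < ℓ) : MetrizedGraph (AddCircle ℓ) Unit where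
  len := fun _ => ℓ
  len_pos := fun _ => hℓ
  param := fun _ t => (t : AddCircle ℓ)
  covers := by
    intro x
    have : Fact (0 < ℓ) := ⟨hℓ⟩
    obtain ⟨t, ht, rfl⟩ := AddCircle.coe_image_Icc_eq (p := ℓ) (a := 0) ▸ mem_univ x
    exact ⟨(), t, by simpa using ht, rfl⟩
  finite_glued := by
    have : Fact (0 < ℓ) := ⟨hℓ⟩
    refine (Set.toFinite ({((), 0), ((), ℓ)} : Set (Unit × ℝ))).subset ?_
    rintro ⟨⟨⟩, t⟩ ⟨ht, ⟨⟨⟩, t'⟩, hne, ht', h⟩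
    simp only [mem_Icc] at ht ht' h
    by_contra hcon
    simp only [mem_insert_iff, Prod.mk.injEq, true_and, mem_singleton_iff, not_or] at hcon
    have htlt : t < ℓ := lt_of_le_of_ne ht.2 hcon.2
    have htpos : 0 < t := lt_of_le_of_ne ht.1 (Ne.symm hcon.1)
    rcases ht'.2.lt_or_eq with hlt | rfl
    · have := (AddCircle.coe_eq_coe_iff_of_mem_Ico (p := ℓ) (a := 0)
        (by simpa using ⟨ht'.1, hlt⟩) (by simpa using ⟨ht.1, htlt⟩)).1 h
      exact hne (by rw [this])
    · rw [AddCircle.coe_period, ← AddCircle.coe_zero] at h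
      have := (AddCircle.coe_eq_coe_iff_of_mem_Ico (p := t') (a := 0)
        (by simpa using hℓ) (by simpa using ⟨ht.1, htlt⟩)).1 h
      exact htpos.ne this
  nonempty := ⟨0⟩
  connected := by
    intro x y
    have : Fact (0 < ℓ) := ⟨hℓ⟩
    obtain ⟨s, hs, rfl⟩ := AddCircle.coe_image_Icc_eq (p := ℓ) (a := 0) ▸ mem_univ x
    obtain ⟨t, ht, rfl⟩ := AddCircle.coe_image_Icc_eq (p := ℓ) (a := 0) ▸ mem_univ y
    exact Relation.ReflTransGen.single
      ⟨(), s, by simpa using hs, t, by simpa using ht, rfl, rfl⟩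

/-- The points of a banana graph with edge lengths `L i`: the two vertices `p` and `q`, and the
interior points of the edges. -/
inductive BananaPoint {m : ℕ} (L : Fin m → ℝ)
  | p : BananaPoint L
  | q : BananaPoint L
  | interior (i : Fin m) (t : ℝ) (ht : t ∈ Ioo 0 (L i)) : BananaPoint L

/-- The parametrization of the `i`-th edge of a banana graph, from `p` to `q`. -/
def BananaPoint.param {m : ℕ} (L : Fin m → ℝ) (i : Fin m) (t : ℝ) : BananaPoint L :=
  if h₀ : t ≤ 0 then BananaPoint.p
  else if h₁ : L i ≤ t then BananaPoint.q
  else BananaPoint.interior i t ⟨not_le.1 h₀, not_le.1 h₁⟩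

theorem BananaPoint.param_of_mem {m : ℕ} (L : Fin m → ℝ) (i : Fin m) (t : ℝ)
    (ht : t ∈ Ioo 0 (L i)) : BananaPoint.param L i t = BananaPoint.interior i t ht := by
  rw [BananaPoint.param, dif_neg (not_le.2 ht.1), dif_neg (not_le.2 ht.2)]

/-- The `m`-banana graph (`m ≥ 1`): two vertices `p`, `q` joined by `m` edges of lengths `L i`. -/
def bananaGraph (m : ℕ) (hm : 1 ≤ m) (L : Fin m → ℝ) (hL : ∀ i, 0 < L i) :
    MetrizedGraph (BananaPoint L) (Fin m) where
  len := L
  len_pos := hL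
  param := BananaPoint.param L
  covers := by
    rintro (_ | _ | ⟨i, t, ht⟩)
    · exact ⟨⟨0, hm⟩, 0, ⟨le_rfl, (hL _).le⟩, by simp [BananaPoint.param]⟩
    · exact ⟨⟨0, hm⟩, L ⟨0, hm⟩, ⟨(hL _).le, le_rfl⟩, by simp [BananaPoint.param, hL]⟩
    · exact ⟨i, t, Ioo_subset_Icc_self ht, BananaPoint.param_of_mem L i t ht⟩
  finite_glued := by
    refine ((Set.finite_range (fun i : Fin m => (i, (0 : ℝ)))).union
      (Set.finite_range (fun i : Fin m => (i, L i)))).subset ?_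
    rintro ⟨i, t⟩ ⟨ht, ⟨j, s⟩, hne, hs, h⟩
    by_contra hcon
    simp only [mem_union, mem_range, Prod.mk.injEq, exists_eq_left, not_or] at hcon
    have h0 : 0 < t := lt_of_le_of_ne ht.1 hcon.1
    have h1 : t < L i := lt_of_le_of_ne ht.2 (Ne.symm hcon.2)
    dsimp only at h
    rw [BananaPoint.param_of_mem L i t ⟨h0, h1⟩, BananaPoint.param] at h
    split_ifs at h
    cases h
    exact hne rfl
  nonempty := ⟨BananaPoint.p⟩
  connected := by
    set R := fun x y : BananaPoint L => ∃ i, ∃ s ∈ Icc 0 (L i), ∃ t ∈ Icc 0 (L i),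
      BananaPoint.param L i s = x ∧ BananaPoint.param L i t = y with hR
    have key : ∀ x, R x BananaPoint.p ∧ R BananaPoint.p x := by
      have h0 : ∀ i, BananaPoint.param L i 0 = BananaPoint.p := fun i => by
        simp [BananaPoint.param]
      rintro (_ | _ | ⟨i, t, ht⟩)
      · exact ⟨⟨⟨0, hm⟩, 0, ⟨le_rfl, (hL _).le⟩, 0, ⟨le_rfl, (hL _).le⟩, h0 _, h0 _⟩,
          ⟨⟨0, hm⟩, 0, ⟨le_rfl, (hL _).le⟩, 0, ⟨le_rfl, (hL _).le⟩, h0 _, h0 _⟩⟩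
      · have h1 : BananaPoint.param L ⟨0, hm⟩ (L ⟨0, hm⟩) = BananaPoint.q := by
          simp [BananaPoint.param, hL]
        exact ⟨⟨⟨0, hm⟩, _, ⟨(hL _).le, le_rfl⟩, 0, ⟨le_rfl, (hL _).le⟩, h1, h0 _⟩,
          ⟨⟨0, hm⟩, 0, ⟨le_rfl, (hL _).le⟩, _, ⟨(hL _).le, le_rfl⟩, h0 _, h1⟩⟩
      · have h1 : BananaPoint.param L i t = BananaPoint.interior i t ht :=
          BananaPoint.param_of_mem L i t ht
        exact ⟨⟨i, t, Ioo_subset_Icc_self ht, 0, ⟨le_rfl, (hL _).le⟩, h1, h0 _⟩,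
          ⟨i, 0, ⟨le_rfl, (hL _).le⟩, t, Ioo_subset_Icc_self ht, h0 _, h1⟩⟩
    intro x y
    exact (Relation.ReflTransGen.single (key x).1).tail (key y).2

end

/-! The proof is the parallel-circuit computation, carried out with a weak form of the Laplace
equation: `f` is a potential for `δ_y - δ_z` when `∫ h' f' = h y - h z` for every test function `h`
that is continuous with bounded derivative off a finite set (`IsPotential`). Green's identity shows
that voltage functions are potentials, and a function of zero energy is constant, so any potential
computes the voltage up to a constant (`IsPotential.voltage_eq`). Existence, without which `voltage`
would be its default value `0`, is a Riesz argument in a finite-dimensional space of piecewise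
affine functions.

The Dirichlet form of a union along `p, q` is the sum of the two forms. Hence a potential on `Γ₁`
extends to the union once a current `α` sent from `p` to `q` through `Γ₁` and back through `Γ₂`
makes the potential drops agree (`exists_isPotential`). Write `g = j_p(·, q)` on `Γ₁`. Solving for
`α` shows that on `Γ₁` the union has `j_p(x, q) = r₂ / (r₁ + r₂) * g x`, and that `j_x(p, q)`
exceeds its value for `Γ₁` by `g x * (r₁ - g x) / (r₁ + r₂)`. As `∫ g (r₁ - g) g'² = r₁³ / 6`
(`weightedEnergy_voltage`), `Γ₁` contributes `(r₂ / (r₁ + r₂))² * (A₁ + r₁³ / (6 (r₁ + r₂)))`;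
adding the contribution of `Γ₂` gives (a). Splitting the integrals needs continuity of `x ↦ j_x(p,
q)`, proved by an energy estimate.

A segment has `A = 0`. A circle is the union of two segments, and a banana graph arises by adding
one segment at a time. These graphs are not literally values of `glue`, so the computation is done
for the abstract `IsTwoPointUnion`. -/

open Filter Topology

noncomputable section

/-! ### Calculus of functions with bounded derivative off a finite set -/

/-- `u` is continuous on `[a, b]`, and off a finite set it is differentiable with bounded
derivative. -/
def RegularOn (u : ℝ → ℝ) (a b : ℝ) : Prop :=
  ContinuousOn u (Icc a b) ∧ ∃ S : Set ℝ, S.Finite ∧ ∃ C, ∀ t ∈ Ioo a b \ S,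
    DifferentiableAt ℝ u t ∧ |deriv u t| ≤ C

theorem integral_congr_off_finite {f g : ℝ → ℝ} {a b : ℝ} (hab : a ≤ b) {S : Set ℝ}
    (hS : S.Finite) (h : ∀ t ∈ Ioo a b \ S, f t = g t) :
    ∫ t in a..b, f t = ∫ t in a..b, g t := by
  apply intervalIntegral.integral_congr_ae
  filter_upwards [(hS.insert b).countable.ae_notMem volume] with t ht hm
  rw [uIoc_of_le hab] at hm
  simp only [mem_insert_iff, not_or] at ht
  exact h t ⟨⟨hm.1, lt_of_le_of_ne hm.2 ht.1⟩, ht.2⟩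

namespace RegularOn

variable {u v : ℝ → ℝ} {a b : ℝ}

theorem of_hasDerivAt (hu : ContinuousOn u (Icc a b)) {S : Set ℝ} (hS : S.Finite) {u' : ℝ → ℝ}
    {C : ℝ} (h : ∀ t ∈ Ioo a b \ S, HasDerivAt u (u' t) t ∧ |u' t| ≤ C) : RegularOn u a b :=
  ⟨hu, S, hS, C, fun t ht =>
    ⟨(h t ht).1.differentiableAt, by rw [(h t ht).1.deriv]; exact (h t ht).2⟩⟩

theorem const (c : ℝ) : RegularOn (fun _ => c) a b :=
  of_hasDerivAt continuousOn_const finite_empty (u' := fun _ => 0) (C := 0)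
    fun t _ => ⟨hasDerivAt_const t c, by simp⟩

theorem add (hu : RegularOn u a b) (hv : RegularOn v a b) : RegularOn (fun t => u t + v t) a b := by
  obtain ⟨hu, S, hS, C, h⟩ := hu
  obtain ⟨hv, T, hT, D, k⟩ := hv
  refine of_hasDerivAt (hu.add hv) (hS.union hT) (u' := fun t => deriv u t + deriv v t)
    (C := C + D) ?_
  rintro t ⟨ht, hST⟩
  simp only [mem_union, not_or] at hST
  obtain ⟨h1, h2⟩ := h t ⟨ht, hST.1⟩
  obtain ⟨k1, k2⟩ := k t ⟨ht, hST.2⟩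
  exact ⟨h1.hasDerivAt.add k1.hasDerivAt, (abs_add_le _ _).trans (add_le_add h2 k2)⟩

theorem mul (hu : RegularOn u a b) (hv : RegularOn v a b) : RegularOn (fun t => u t * v t) a b := by
  obtain ⟨A, hA⟩ := isCompact_Icc.exists_bound_of_continuousOn hu.1
  obtain ⟨B, hB⟩ := isCompact_Icc.exists_bound_of_continuousOn hv.1
  obtain ⟨hu, S, hS, C, h⟩ := hu
  obtain ⟨hv, T, hT, D, k⟩ := hv
  refine of_hasDerivAt (hu.mul hv) (hS.union hT) (u' := fun t => deriv u t * v t + u t * deriv v t)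
    (C := C * B + A * D) ?_
  rintro t ⟨ht, hST⟩
  simp only [mem_union, not_or] at hST
  obtain ⟨h1, h2⟩ := h t ⟨ht, hST.1⟩
  obtain ⟨k1, k2⟩ := k t ⟨ht, hST.2⟩
  refine ⟨h1.hasDerivAt.mul k1.hasDerivAt, (abs_add_le _ _).trans ?_⟩
  have hA' := hA t (Ioo_subset_Icc_self ht)
  have hB' := hB t (Ioo_subset_Icc_self ht)
  rw [Real.norm_eq_abs] at hA' hB'
  rw [abs_mul, abs_mul]
  have := abs_nonneg (deriv u t)
  have := abs_nonneg (u t)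
  gcongr
  · linarith
  · linarith

theorem const_mul (c : ℝ) (hu : RegularOn u a b) : RegularOn (fun t => c * u t) a b :=
  (const c).mul hu

theorem mono (hu : RegularOn u a b) {a' b' : ℝ} (ha : a ≤ a') (hb : b' ≤ b) :
    RegularOn u a' b' := by
  obtain ⟨hu, S, hS, C, h⟩ := hu
  exact ⟨hu.mono (Icc_subset_Icc ha hb), S, hS, C,
    fun t ht => h t ⟨Ioo_subset_Ioo ha hb ht.1, ht.2⟩⟩

theorem congr (hu : RegularOn u a b) (h : EqOn v u (Icc a b)) : RegularOn v a b := by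
  obtain ⟨hu, S, hS, C, k⟩ := hu
  refine of_hasDerivAt (hu.congr h) hS (u' := deriv u) (C := C) fun t ht => ?_
  refine ⟨(k t ht).1.hasDerivAt.congr_of_eventuallyEq ?_, (k t ht).2⟩
  filter_upwards [Icc_mem_nhds ht.1.1 ht.1.2] with s hs using h hs

theorem trans {c : ℝ} (hu : RegularOn u a b) (hv : RegularOn u b c) (hab : a ≤ b) (hbc : b ≤ c) :
    RegularOn u a c := by
  obtain ⟨hu, S, hS, C, h⟩ := hu
  obtain ⟨hv, T, hT, D, k⟩ := hv
  refine ⟨?_, insert b (S ∪ T), (hS.union hT).insert b, max C D, ?_⟩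
  · rw [← Icc_union_Icc_eq_Icc hab hbc]
    exact hu.union_of_isClosed hv isClosed_Icc isClosed_Icc
  · rintro t ⟨ht, hb⟩
    simp only [mem_insert_iff, mem_union, not_or] at hb
    rcases lt_or_gt_of_ne hb.1 with hlt | hlt
    · have := h t ⟨⟨ht.1, hlt⟩, hb.2.1⟩
      exact ⟨this.1, this.2.trans (le_max_left _ _)⟩
    · have := k t ⟨⟨hlt, ht.2⟩, hb.2.2⟩
      exact ⟨this.1, this.2.trans (le_max_right _ _)⟩

theorem comp_const_add (c : ℝ) (hu : RegularOn u (c + a) (c + b)) :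
    RegularOn (fun t => u (c + t)) a b := by
  obtain ⟨hu, S, hS, C, h⟩ := hu
  have hm : ∀ t ∈ Icc a b, c + t ∈ Icc (c + a) (c + b) := fun t ht => by
    simpa using ht
  refine ⟨hu.comp (by fun_prop) hm, (fun t => c + t) ⁻¹' S,
    hS.preimage (add_right_injective c).injOn, C, fun t ht => ?_⟩
  have := h (c + t) ⟨by simpa using ht.1, ht.2⟩
  rw [deriv_comp_const_add]
  exact ⟨this.1.comp t (by fun_prop), this.2⟩

theorem comp_const_sub (c : ℝ) (hu : RegularOn u (c - b) (c - a)) :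
    RegularOn (fun t => u (c - t)) a b := by
  obtain ⟨hu, S, hS, C, h⟩ := hu
  have hm : ∀ t ∈ Icc a b, c - t ∈ Icc (c - b) (c - a) := fun t ht =>
    ⟨by linarith [ht.2], by linarith [ht.1]⟩
  refine ⟨hu.comp (by fun_prop) hm, (fun t => c - t) ⁻¹' S,
    hS.preimage (sub_right_injective).injOn, C, fun t ht => ?_⟩
  have := h (c - t) ⟨⟨by linarith [ht.1.2], by linarith [ht.1.1]⟩, ht.2⟩
  rw [deriv_comp_const_sub, abs_neg]
  exact ⟨this.1.comp t (by fun_prop), this.2⟩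

theorem intervalIntegrable_weighted {F : ℝ → ℝ} (hF : ContinuousOn F (Icc a b))
    (hu : RegularOn u a b) (hv : RegularOn v a b) (hab : a ≤ b) :
    IntervalIntegrable (fun t => F t * (deriv u t * deriv v t)) volume a b := by
  obtain ⟨A, hA⟩ := isCompact_Icc.exists_bound_of_continuousOn hF
  obtain ⟨-, S, hS, C, h⟩ := hu
  obtain ⟨-, T, hT, D, k⟩ := hv
  rw [intervalIntegrable_iff_integrableOn_Ioo_of_le hab]
  have hm : AEStronglyMeasurable (fun t => F t * (deriv u t * deriv v t))
      (volume.restrict (Ioo a b)) := by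
    refine ((hF.mono Ioo_subset_Icc_self).aestronglyMeasurable measurableSet_Ioo).mul ?_
    exact ((measurable_deriv u).mul (measurable_deriv v)).aestronglyMeasurable
  refine IntegrableOn.of_bound (C := A * (C * D)) (by simp) hm ?_
  filter_upwards [ae_restrict_mem measurableSet_Ioo,
    ae_restrict_of_ae ((hS.union hT).countable.ae_notMem volume)] with t ht hn
  simp only [mem_union, not_or] at hn
  have h1 := (h t ⟨ht, hn.1⟩).2
  have h2 := (k t ⟨ht, hn.2⟩).2
  have h3 := hA t (Ioo_subset_Icc_self ht)
  rw [norm_mul, norm_mul, Real.norm_eq_abs (deriv u t), Real.norm_eq_abs (deriv v t)]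
  have := abs_nonneg (deriv u t)
  have := abs_nonneg (deriv v t)
  have := norm_nonneg (F t)
  have hC : 0 ≤ C := by linarith
  gcongr
  linarith

theorem intervalIntegrable_deriv (hu : RegularOn u a b) (hab : a ≤ b) :
    IntervalIntegrable (deriv u) volume a b := by
  obtain ⟨-, S, hS, C, h⟩ := hu
  rw [intervalIntegrable_iff_integrableOn_Ioo_of_le hab]
  refine IntegrableOn.of_bound (C := C) (by simp)
    (measurable_deriv u).aestronglyMeasurable ?_
  filter_upwards [ae_restrict_mem measurableSet_Ioo,
      ae_restrict_of_ae (hS.countable.ae_notMem volume)] with t ht hn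
  exact (h t ⟨ht, hn⟩).2

theorem integral_deriv (hu : RegularOn u a b) (hab : a ≤ b) :
    ∫ t in a..b, deriv u t = u b - u a := by
  have hi := hu.intervalIntegrable_deriv hab
  obtain ⟨hc, S, hS, C, h⟩ := hu
  refine integral_eq_of_hasDerivAt_off_countable_of_le u (deriv u) hab hS.countable hc
    (fun t ht => (h t ht).1.hasDerivAt) hi

theorem exists_finite_hasDerivAt (hu : RegularOn u a b) :
    ∃ S : Set ℝ, S.Finite ∧ ∀ t ∈ Ioo a b \ S, HasDerivAt u (deriv u t) t := by
  obtain ⟨-, S, hS, C, h⟩ := hu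
  exact ⟨S, hS, fun t ht => (h t ht).1.hasDerivAt⟩

theorem integral_weighted_add {F w : ℝ → ℝ} (hF : ContinuousOn F (Icc a b))
    (hw : RegularOn w a b) (hu : RegularOn u a b) (hv : RegularOn v a b) (hab : a ≤ b) :
    ∫ t in a..b, F t * (deriv w t * deriv (fun s => u s + v s) t) =
      (∫ t in a..b, F t * (deriv w t * deriv u t)) +
        ∫ t in a..b, F t * (deriv w t * deriv v t) := by
  rw [← intervalIntegral.integral_add (intervalIntegrable_weighted hF hw hu hab)
    (intervalIntegrable_weighted hF hw hv hab)]
  obtain ⟨S, hS, h⟩ := hu.exists_finite_hasDerivAt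
  obtain ⟨T, hT, k⟩ := hv.exists_finite_hasDerivAt
  refine integral_congr_off_finite hab (hS.union hT) fun t ht => ?_
  have ht' := ht.2
  simp only [mem_union, not_or] at ht'
  rw [((h t ⟨ht.1, ht'.1⟩).fun_add (k t ⟨ht.1, ht'.2⟩)).deriv]
  ring

end RegularOn

/-! ### Piecewise affine functions on an interval and Green's identity -/

/-- `u` coincides with an affine function near `t`. -/
def LocallyAffineAt (u : ℝ → ℝ) (t : ℝ) : Prop := ∃ c d : ℝ, ∀ᶠ s in 𝓝 t, u s = c + d * s

theorem hasDerivAt_affine (c d t : ℝ) : HasDerivAt (fun s => c + d * s) d t := by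
  simpa using ((hasDerivAt_id t).const_mul d).const_add c

theorem affine_of_deriv_deriv_eq_zero {u : ℝ → ℝ} {a b : ℝ}
    (h : ∀ t ∈ Ioo a b, DifferentiableAt ℝ u t ∧ HasDerivAt (deriv u) 0 t) :
    ∃ c d : ℝ, ∀ t ∈ Ioo a b, u t = c + d * t := by
  rcases (Ioo a b).eq_empty_or_nonempty with he | ⟨m, hm⟩
  · exact ⟨0, 0, by simp [he]⟩
  have h1 : ∀ t ∈ Ioo a b, deriv u t = deriv u m := fun t ht =>
    isOpen_Ioo.is_const_of_deriv_eq_zero isPreconnected_Ioo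
      (fun s hs => (h s hs).2.differentiableAt.differentiableWithinAt)
      (fun s hs => (h s hs).2.deriv) ht hm
  have h2 : ∀ s ∈ Ioo a b, HasDerivAt (fun t => u t - deriv u m * t) 0 s := fun s hs => by
    have := (h s hs).1.hasDerivAt.fun_sub ((hasDerivAt_id s).const_mul (deriv u m))
    rw [h1 s hs] at this
    simpa using this
  have h3 : ∀ t ∈ Ioo a b, u t - deriv u m * t = u m - deriv u m * m := fun t ht =>
    isOpen_Ioo.is_const_of_deriv_eq_zero isPreconnected_Ioo
      (fun s hs => (h2 s hs).differentiableAt.differentiableWithinAt)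
      (fun s hs => (h2 s hs).deriv) ht hm
  exact ⟨u m - deriv u m * m, deriv u m, fun t ht => by linarith [h3 t ht]⟩

namespace LocallyAffineAt

variable {u v : ℝ → ℝ} {t : ℝ}

theorem add (hu : LocallyAffineAt u t) (hv : LocallyAffineAt v t) :
    LocallyAffineAt (fun s => u s + v s) t := by
  obtain ⟨c, d, h⟩ := hu
  obtain ⟨c', d', h'⟩ := hv
  refine ⟨c + c', d + d', ?_⟩
  filter_upwards [h, h'] with s h1 h2
  rw [h1, h2]; ring

theorem const_mul (k : ℝ) (hu : LocallyAffineAt u t) : LocallyAffineAt (fun s => k * u s) t := by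
  obtain ⟨c, d, h⟩ := hu
  refine ⟨k * c, k * d, ?_⟩
  filter_upwards [h] with s h1
  rw [h1]; ring

theorem const (c : ℝ) : LocallyAffineAt (fun _ => c) t := ⟨c, 0, by simp⟩

theorem congr (hu : LocallyAffineAt u t) (h : v =ᶠ[𝓝 t] u) : LocallyAffineAt v t := by
  obtain ⟨c, d, h'⟩ := hu
  exact ⟨c, d, by filter_upwards [h, h'] with s h1 h2 using h1.trans h2⟩

theorem hasDerivAt_deriv (hu : LocallyAffineAt u t) :
    DifferentiableAt ℝ u t ∧ HasDerivAt (deriv u) 0 t := by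
  obtain ⟨c, d, h⟩ := hu
  refine ⟨((hasDerivAt_affine c d t).congr_of_eventuallyEq h).differentiableAt, ?_⟩
  refine (hasDerivAt_const t d).congr_of_eventuallyEq ?_
  filter_upwards [h.eventually_nhds] with s hs
  exact ((hasDerivAt_affine c d s).congr_of_eventuallyEq hs).deriv

theorem contDiffAt (hu : LocallyAffineAt u t) : ContDiffAt ℝ 2 u t := by
  obtain ⟨c, d, h⟩ := hu
  exact ContDiffAt.congr_of_eventuallyEq (f := fun s => c + d * s) (by fun_prop) h

end LocallyAffineAt

theorem affine_of_locallyAffineAt {u : ℝ → ℝ} {a b : ℝ} (hab : a < b)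
    (hu : ContinuousOn u (Icc a b)) (h : ∀ t ∈ Ioo a b, LocallyAffineAt u t) :
    ∃ c d : ℝ, ∀ t ∈ Icc a b, u t = c + d * t := by
  obtain ⟨c, d, hcd⟩ := affine_of_deriv_deriv_eq_zero fun t ht => (h t ht).hasDerivAt_deriv
  refine ⟨c, d, ?_⟩
  have : EqOn u (fun t => c + d * t) (closure (Ioo a b)) := by
    refine EqOn.of_subset_closure (s := Ioo a b) hcd ?_ (by fun_prop) subset_closure subset_rfl
    rwa [closure_Ioo hab.ne]
  rwa [closure_Ioo hab.ne] at this

/-- The piecewise affine function `c + ∑ s ∈ S, k s (t - s)⁺`. -/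
def hinge (S : Finset ℝ) (c : ℝ) (k : ℝ → ℝ) (t : ℝ) : ℝ := c + ∑ s ∈ S, k s * max (t - s) 0

/-- A new largest node `m` is fitted by changing only the slope at the previous largest node `n`;
this leaves all values at points `≤ n` untouched. -/
theorem exists_hinge_interpolating (S : Finset ℝ) (φ : ℝ → ℝ) :
    ∃ c k, ∀ s ∈ S, hinge S c k s = φ s := by
  induction S using Finset.induction_on_max with
  | empty => exact ⟨0, 0, by simp⟩
  | insert m S hm ih =>
    obtain ⟨c, k, h⟩ := ih
    have hmS : m ∉ S := fun h => lt_irrefl _ (hm m h)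
    rcases S.eq_empty_or_nonempty with rfl | hS
    · exact ⟨φ m, 0, by simp [hinge]⟩
    · set n := S.max' hS with hn
      have hnS : n ∈ S := S.max'_mem hS
      have hnm : n < m := hm n hnS
      have key : ∀ t ≤ m, hinge (insert m S)
          c (k + Pi.single n ((φ m - hinge S c k m) / (m - n))) t =
          hinge S c k t + (φ m - hinge S c k m) / (m - n) * max (t - n) 0 := by
        intro t ht
        simp only [hinge]
        rw [Finset.sum_insert hmS, max_eq_right (by linarith : t - m ≤ 0)]
        simp only [Pi.add_apply, add_mul, Finset.sum_add_distrib, mul_zero, zero_add]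
        rw [Finset.sum_eq_single n (f := fun x => (Pi.single n _ : ℝ → ℝ) x * max (t - x) 0)
          (fun s _ hs => by rw [Pi.single_eq_of_ne hs, zero_mul]) (fun h => absurd hnS h)]
        rw [Pi.single_eq_same]
        ring
      refine ⟨c, k + Pi.single n ((φ m - hinge S c k m) / (m - n)), fun s hs => ?_⟩
      rcases Finset.mem_insert.1 hs with rfl | hs
      · rw [key s le_rfl, max_eq_left (by linarith)]
        field_simp [sub_ne_zero.2 hnm.ne']
        ring
      · rw [key s (hm s hs).le, max_eq_right (by linarith [S.le_max' s hs]), h s hs]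
        ring

theorem continuous_hinge (S : Finset ℝ) (c : ℝ) (k : ℝ → ℝ) : Continuous (hinge S c k) := by
  unfold hinge
  fun_prop

/-- The node `s = t` counts for the right slope but not for the left one, so the slope jumps by `k
t` at a node `t`. -/
theorem hasDerivWithinAt_Ici_hinge (S : Finset ℝ) (c : ℝ) (k : ℝ → ℝ) (t : ℝ) :
    HasDerivWithinAt (hinge S c k) (∑ s ∈ S, k s * (if s ≤ t then 1 else 0)) (Ici t) t := by
  refine (HasDerivWithinAt.fun_sum fun s _ => HasDerivWithinAt.const_mul _ ?_).const_add c
  split_ifs with h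
  · refine ((hasDerivWithinAt_id t _).sub_const s).congr (fun x hx => ?_) ?_
    · exact max_eq_left (sub_nonneg.2 (h.trans hx))
    · exact max_eq_left (sub_nonneg.2 h)
  · refine ((hasDerivAt_const t (0 : ℝ)).congr_of_eventuallyEq ?_).hasDerivWithinAt
    filter_upwards [Iio_mem_nhds (not_le.1 h)] with x hx
    exact max_eq_right (sub_nonpos.2 (le_of_lt hx))

theorem hasDerivWithinAt_Iic_hinge (S : Finset ℝ) (c : ℝ) (k : ℝ → ℝ) (t : ℝ) :
    HasDerivWithinAt (hinge S c k) (∑ s ∈ S, k s * (if s < t then 1 else 0)) (Iic t) t := by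
  refine (HasDerivWithinAt.fun_sum fun s _ => HasDerivWithinAt.const_mul _ ?_).const_add c
  split_ifs with h
  · refine (((hasDerivAt_id t).sub_const s).congr_of_eventuallyEq ?_).hasDerivWithinAt
    filter_upwards [Ioi_mem_nhds h] with x hx
    exact max_eq_left (sub_nonneg.2 (le_of_lt hx))
  · refine (hasDerivWithinAt_const t _ (0 : ℝ)).congr (fun x hx => ?_) ?_
    · exact max_eq_right (sub_nonpos.2 (le_trans hx (not_lt.1 h)))
    · exact max_eq_right (sub_nonpos.2 (not_lt.1 h))

theorem hinge_locallyAffineAt (S : Finset ℝ) (c : ℝ) (k : ℝ → ℝ) {t : ℝ} (ht : t ∉ S) :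
    LocallyAffineAt (hinge S c k) t := by
  have key : ∀ s ≠ t, LocallyAffineAt (fun t => max (t - s) 0) t := by
    intro s hs
    rcases lt_or_gt_of_ne hs with h | h
    · refine ⟨-s, 1, ?_⟩
      filter_upwards [Ioi_mem_nhds h] with x hx
      rw [max_eq_left (sub_nonneg.2 (le_of_lt hx))]; ring
    · refine ⟨0, 0, ?_⟩
      filter_upwards [Iio_mem_nhds h] with x hx
      rw [max_eq_right (sub_nonpos.2 (le_of_lt hx))]; ring
  have : ∀ T ⊆ S, LocallyAffineAt (fun x => ∑ s ∈ T, k s * max (x - s) 0) t := by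
    intro T
    induction T using Finset.induction_on with
    | empty => intro _; simpa using LocallyAffineAt.const 0
    | insert s T hs ih =>
      intro hT
      simp only [Finset.sum_insert hs]
      exact ((key s (fun h => ht (h ▸ hT (Finset.mem_insert_self s T)))).const_mul _).add
        (ih ((Finset.subset_insert s T).trans hT))
  exact (LocallyAffineAt.const c).add (this S subset_rfl)

/-- A continuous function that is affine off a finite set is a hinge function. -/
theorem exists_hinge_eq {u : ℝ → ℝ} {L : ℝ} {S : Finset ℝ} (h0 : 0 ∈ S)
    (hL : L ∈ S) (hu : ContinuousOn u (Icc 0 L))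
    (h : ∀ t ∈ Ioo 0 L, t ∉ S → LocallyAffineAt u t) :
    ∃ c k, ∀ t ∈ Icc 0 L, u t = hinge S c k t := by
  obtain ⟨c, k, hck⟩ := exists_hinge_interpolating S u
  refine ⟨c, k, fun t ht => ?_⟩
  by_cases htS : t ∈ S
  · exact (hck t htS).symm
  have h0t : 0 < t := ht.1.lt_of_ne fun h => htS (h ▸ h0)
  have htL : t < L := ht.2.lt_of_ne fun h => htS (h ▸ hL)
  have hA : (S.filter (· < t)).Nonempty := ⟨0, Finset.mem_filter.2 ⟨h0, h0t⟩⟩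
  have hB : (S.filter (t < ·)).Nonempty := ⟨L, Finset.mem_filter.2 ⟨hL, htL⟩⟩
  -- `a` and `b` are the nodes adjacent to `t`. On `[a, b]` both `u` and the interpolating hinge
  -- function are affine, and they agree at both ends.
  set a := (S.filter (· < t)).max' hA
  set b := (S.filter (t < ·)).min' hB
  obtain ⟨haS, hat⟩ := Finset.mem_filter.1 ((S.filter (· < t)).max'_mem hA)
  obtain ⟨hbS, htb⟩ := Finset.mem_filter.1 ((S.filter (t < ·)).min'_mem hB)
  have ha0 : 0 ≤ a := Finset.le_max' _ _ (Finset.mem_filter.2 ⟨h0, h0t⟩)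
  have hbL : b ≤ L := Finset.min'_le _ _ (Finset.mem_filter.2 ⟨hL, htL⟩)
  have hgap : ∀ s ∈ Ioo a b, s ∉ S := by
    intro s hs hsS
    rcases lt_trichotomy s t with hst | rfl | hst
    · exact absurd (Finset.le_max' _ _ (Finset.mem_filter.2 ⟨hsS, hst⟩)) (not_le.2 hs.1)
    · exact htS hsS
    · exact absurd (Finset.min'_le _ _ (Finset.mem_filter.2 ⟨hsS, hst⟩)) (not_le.2 hs.2)
  have hab : a < b := hat.trans htb
  obtain ⟨c1, d1, e1⟩ := affine_of_locallyAffineAt hab (hu.mono (Icc_subset_Icc ha0 hbL))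
    fun s hs => h s (Ioo_subset_Ioo ha0 hbL hs) (hgap s hs)
  obtain ⟨c2, d2, e2⟩ := affine_of_locallyAffineAt hab (continuous_hinge S c k).continuousOn
    fun s hs => hinge_locallyAffineAt S c k (hgap s hs)
  have ea := hck a haS
  have eb := hck b hbS
  rw [e1 a ⟨le_rfl, hab.le⟩, e2 a ⟨le_rfl, hab.le⟩] at ea
  rw [e1 b ⟨hab.le, le_rfl⟩, e2 b ⟨hab.le, le_rfl⟩] at eb
  have hd : d1 = d2 := by
    have : (d1 - d2) * (b - a) = 0 := by linarith
    rcases mul_eq_zero.1 this with h | h <;> linarith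
  subst hd
  rw [e1 t ⟨hat.le, htb.le⟩, e2 t ⟨hat.le, htb.le⟩]
  linarith

theorem hasDerivAt_hinge (S : Finset ℝ) (c : ℝ) (k : ℝ → ℝ) {t : ℝ} (ht : t ∉ S) :
    HasDerivAt (hinge S c k) (∑ s ∈ S, k s * (if s < t then 1 else 0)) t := by
  have h1 := hasDerivWithinAt_Ici_hinge S c k t
  have : ∑ s ∈ S, k s * (if s ≤ t then (1 : ℝ) else 0) =
      ∑ s ∈ S, k s * (if s < t then 1 else 0) := by
    refine Finset.sum_congr rfl fun s hs => ?_
    have : s ≠ t := fun h => ht (h ▸ hs)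
    simp only [le_iff_lt_or_eq, this, or_false]
  rw [this] at h1
  have := (hasDerivWithinAt_Iic_hinge S c k t).union h1
  rwa [Iic_union_Ici, hasDerivWithinAt_univ] at this

theorem regularOn_hinge (S : Finset ℝ) (c : ℝ) (k : ℝ → ℝ) (a b : ℝ) :
    RegularOn (hinge S c k) a b := by
  refine RegularOn.of_hasDerivAt (continuous_hinge S c k).continuousOn S.finite_toSet
    (u' := fun t => ∑ s ∈ S, k s * (if s < t then 1 else 0)) (C := ∑ s ∈ S, |k s|)
    fun t ht => ⟨hasDerivAt_hinge S c k ht.2, ?_⟩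
  refine (Finset.abs_sum_le_sum_abs _ _).trans (Finset.sum_le_sum fun s _ => ?_)
  split_ifs <;> simp

/-- The derivative of a hinge function is a sum of steps `k s * 1_{s < t}`, and the integral of `w'`
over `[s, L]` is `w L - w s`. -/
theorem integral_deriv_mul_deriv_hinge {w : ℝ → ℝ} {L : ℝ} {S : Finset ℝ}
    (hS : ∀ s ∈ S, s ∈ Icc 0 L) (c : ℝ) (k : ℝ → ℝ) (hL0 : 0 ≤ L) (hw : RegularOn w 0 L) :
    ∫ t in (0 : ℝ)..L, deriv w t * deriv (hinge S c k) t = ∑ s ∈ S, k s * (w L - w s) := by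
  have hint : ∀ s ∈ S, IntervalIntegrable (fun t => k s * (if s < t then deriv w t else 0))
      volume 0 L := by
    intro s _
    refine IntervalIntegrable.const_mul ?_ _
    have h := hw.intervalIntegrable_deriv hL0
    rw [intervalIntegrable_iff] at h ⊢
    exact h.indicator (measurableSet_Ioi (a := s))
  calc ∫ t in (0 : ℝ)..L, deriv w t * deriv (hinge S c k) t
      = ∫ t in (0 : ℝ)..L, ∑ s ∈ S, k s * (if s < t then deriv w t else 0) := by
        refine integral_congr_off_finite hL0 S.finite_toSet fun t ht => ?_
        rw [(hasDerivAt_hinge S c k ht.2).deriv, Finset.mul_sum]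
        refine Finset.sum_congr rfl fun s _ => ?_
        split_ifs <;> ring
    _ = ∑ s ∈ S, ∫ t in (0 : ℝ)..L, k s * (if s < t then deriv w t else 0) :=
        intervalIntegral.integral_finsetSum hint
    _ = ∑ s ∈ S, k s * (w L - w s) := by
        refine Finset.sum_congr rfl fun s hs => ?_
        have hs' := hS s hs
        rw [intervalIntegral.integral_const_mul]
        congr 1
        have hi := hint s hs
        rw [← (hw.mono hs'.1 le_rfl).integral_deriv hs'.2]
        have h1 : ∫ t in (0 : ℝ)..L, (if s < t then deriv w t else 0) =
            ∫ t in Ioc 0 L, (Ioi s).indicator (deriv w) t := by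
          rw [intervalIntegral.integral_of_le hL0]; rfl
        rw [h1, setIntegral_indicator measurableSet_Ioi, intervalIntegral.integral_of_le hs'.2,
          Ioc_inter_Ioi, max_eq_right hs'.1]

/-- Green's identity on a segment. -/
theorem integral_deriv_mul_deriv_eq_sum {u w : ℝ → ℝ} {L : ℝ} {S : Finset ℝ} (hL0 : 0 < L)
    (hS : ∀ s ∈ S, s ∈ Icc 0 L) (h0 : 0 ∈ S) (hL : L ∈ S) (hu : ContinuousOn u (Icc 0 L))
    (h : ∀ t ∈ Ioo 0 L, t ∉ S → LocallyAffineAt u t) (hw : RegularOn w 0 L) :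
    ∫ t in (0 : ℝ)..L, deriv w t * deriv u t =
      -∑ t ∈ S, w t * (derivWithin u (Icc t L) t - derivWithin u (Icc 0 t) t) := by
  obtain ⟨c, k, e⟩ := exists_hinge_eq h0 hL hu h
  have hI : ∫ t in (0 : ℝ)..L, deriv w t * deriv u t =
      ∫ t in (0 : ℝ)..L, deriv w t * deriv (hinge S c k) t := by
    refine integral_congr_off_finite hL0.le finite_empty fun t ht => ?_
    congr 1
    refine Filter.EventuallyEq.deriv_eq ?_
    filter_upwards [Icc_mem_nhds ht.1.1 ht.1.2] with s hs using e s hs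
  have hr : ∀ t ∈ S, t < L → derivWithin u (Icc t L) t =
      ∑ s ∈ S, k s * (if s ≤ t then 1 else 0) := by
    intro t ht htL
    refine HasDerivWithinAt.derivWithin ?_ (uniqueDiffOn_Icc htL t ⟨le_rfl, htL.le⟩)
    exact ((hasDerivWithinAt_Ici_hinge S c k t).mono Icc_subset_Ici_self).congr
      (fun x hx => e x ⟨(hS t ht).1.trans hx.1, hx.2⟩) (e t (hS t ht))
  have hl : ∀ t ∈ S, 0 < t → derivWithin u (Icc 0 t) t =
      ∑ s ∈ S, k s * (if s < t then 1 else 0) := by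
    intro t ht ht0
    refine HasDerivWithinAt.derivWithin ?_ (uniqueDiffOn_Icc ht0 t ⟨ht0.le, le_rfl⟩)
    exact ((hasDerivWithinAt_Iic_hinge S c k t).mono Icc_subset_Iic_self).congr
      (fun x hx => e x ⟨hx.1, hx.2.trans (hS t ht).2⟩) (e t (hS t ht))
  -- A missing direction at an end point contributes `0`, since a one-point set has no accumulation
  -- point.
  have hsub : ∀ (f : ℝ → ℝ) (t : ℝ), derivWithin f (Icc t t) t = 0 := fun f t => by
    rw [Icc_self]
    exact derivWithin_zero_of_not_accPt fun h => by simpa using accPt_iff_frequently.1 h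
  -- Below `L` the slope jump is `k t`, also at `t = 0`, where no node lies to the left. At `L` only
  -- minus the final slope remains.
  have hdiff : ∀ t ∈ S, derivWithin u (Icc t L) t - derivWithin u (Icc 0 t) t =
      if t < L then k t else -∑ s ∈ S, k s * (if s < L then 1 else 0) := by
    intro t ht
    split_ifs with htL
    · have h2 : derivWithin u (Icc 0 t) t = ∑ s ∈ S, k s * (if s < t then 1 else 0) := by
        rcases (hS t ht).1.eq_or_lt with rfl | h
        · rw [hsub, Finset.sum_eq_zero]
          intro s hs
          rw [if_neg (not_lt.2 (hS s hs).1), mul_zero]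
        · exact hl t ht h
      rw [hr t ht htL, h2, ← Finset.sum_sub_distrib, Finset.sum_eq_single t]
      · simp
      · intro s _ hs
        simp only [le_iff_lt_or_eq, hs, or_false, sub_self]
      · exact fun h => absurd ht h
    · have : t = L := le_antisymm (hS t ht).2 (not_lt.1 htL)
      subst this
      rw [hsub, hl t ht hL0, zero_sub]
  rw [hI, integral_deriv_mul_deriv_hinge hS c k hL0.le hw,
    Finset.sum_congr (s₁ := S) (f := fun t => w t * _) rfl fun t ht => by rw [hdiff t ht]]
  have e1 : ∀ t, w t * (if t < L then k t else -∑ s ∈ S, k s * (if s < L then 1 else 0)) =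
      (if t < L then w t * k t else 0) +
        (if t < L then 0 else w t * -∑ s ∈ S, k s * (if s < L then 1 else 0)) := by
    intro t; split_ifs <;> ring
  simp only [e1, Finset.sum_add_distrib]
  rw [Finset.sum_eq_single L (f := fun t => if t < L then (0 : ℝ) else _)]
  -- The final slope at `L` supplies every term `k s * w L`; the summand `s = L` is zero on both
  -- sides.
  · rw [if_neg (lt_irrefl L), mul_neg, Finset.mul_sum, neg_add, neg_neg, ← Finset.sum_neg_distrib,
      ← Finset.sum_add_distrib]
    refine Finset.sum_congr rfl fun s hs => ?_
    split_ifs with hsL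
    · ring
    · rw [le_antisymm (hS s hs).2 (not_lt.1 hsL)]; ring
  · intro t ht htL
    rw [if_pos (lt_of_le_of_ne (hS t ht).2 htL)]
  · exact fun h => absurd hL h

theorem regularOn_of_locallyAffineAt {u : ℝ → ℝ} {L : ℝ} {S : Finset ℝ} (h0 : 0 ∈ S)
    (hL : L ∈ S) (hu : ContinuousOn u (Icc 0 L))
    (h : ∀ t ∈ Ioo 0 L, t ∉ S → LocallyAffineAt u t) : RegularOn u 0 L := by
  obtain ⟨c, k, e⟩ := exists_hinge_eq h0 hL hu h
  exact (regularOn_hinge S c k 0 L).congr e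

/-! ### The Dirichlet form of a metrized graph -/

namespace MetrizedGraph

variable {X E : Type*} [Fintype E] (Γ : MetrizedGraph X E)

/-- The condition imposed on weights: continuity is all that is established for `x ↦ j_x(p, q)`. -/
def EdgeContinuous (f : X → ℝ) : Prop :=
  ∀ e, ContinuousOn (fun t => f (Γ.param e t)) (Icc 0 (Γ.len e))

/-- The test functions of the weak formulation. -/
def Regular (f : X → ℝ) : Prop := ∀ e, RegularOn (fun t => f (Γ.param e t)) 0 (Γ.len e)

/-- The Dirichlet form `∫ F k' f'` with weight `F`. -/
def weightedEnergy (F k f : X → ℝ) : ℝ :=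
  ∑ e, ∫ t in (0 : ℝ)..Γ.len e, F (Γ.param e t) *
    (deriv (fun s => k (Γ.param e s)) t * deriv (fun s => f (Γ.param e s)) t)

/-- The Dirichlet form `∫ k' f'`. -/
def energy (k f : X → ℝ) : ℝ := Γ.weightedEnergy (fun _ => 1) k f

variable {Γ}

theorem EdgeContinuous.const (c : ℝ) : Γ.EdgeContinuous fun _ => c := fun _ => continuousOn_const

theorem EdgeContinuous.add {f g : X → ℝ} (hf : Γ.EdgeContinuous f) (hg : Γ.EdgeContinuous g) :
    Γ.EdgeContinuous fun x => f x + g x := fun e => (hf e).add (hg e)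

theorem EdgeContinuous.mul {f g : X → ℝ} (hf : Γ.EdgeContinuous f) (hg : Γ.EdgeContinuous g) :
    Γ.EdgeContinuous fun x => f x * g x := fun e => (hf e).mul (hg e)

namespace Regular

variable {F G f g k : X → ℝ}

theorem edgeContinuous (hf : Γ.Regular f) : Γ.EdgeContinuous f := fun e => (hf e).1

theorem const (c : ℝ) : Γ.Regular fun _ => c := fun _ => RegularOn.const c

theorem add (hf : Γ.Regular f) (hg : Γ.Regular g) : Γ.Regular fun x => f x + g x :=
  fun e => (hf e).add (hg e)

theorem mul (hf : Γ.Regular f) (hg : Γ.Regular g) : Γ.Regular fun x => f x * g x :=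
  fun e => (hf e).mul (hg e)

theorem const_mul (c : ℝ) (hf : Γ.Regular f) : Γ.Regular fun x => c * f x :=
  fun e => (hf e).const_mul c

theorem linear (c d : ℝ) (hf : Γ.Regular f) (hg : Γ.Regular g) :
    Γ.Regular fun x => c * f x + d * g x := (hf.const_mul c).add (hg.const_mul d)

end Regular

section energy

variable {F G f g k : X → ℝ}

theorem weightedEnergy_comm (F k f : X → ℝ) :
    Γ.weightedEnergy F k f = Γ.weightedEnergy F f k := by
  simp only [weightedEnergy, mul_comm (deriv (fun s => k (Γ.param _ s)) _)]

theorem energy_comm (k f : X → ℝ) : Γ.energy k f = Γ.energy f k := weightedEnergy_comm _ k f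

theorem weightedEnergy_add_right (hF : Γ.EdgeContinuous F) (hk : Γ.Regular k) (hf : Γ.Regular f)
    (hg : Γ.Regular g) : Γ.weightedEnergy F k (fun x => f x + g x) =
      Γ.weightedEnergy F k f + Γ.weightedEnergy F k g := by
  simp only [weightedEnergy, ← Finset.sum_add_distrib]
  exact Finset.sum_congr rfl fun e _ => RegularOn.integral_weighted_add (hF e) (hk e) (hf e) (hg e)
    (Γ.len_pos e).le

theorem weightedEnergy_const_mul_right (c : ℝ) :
    Γ.weightedEnergy F k (fun x => c * f x) = c * Γ.weightedEnergy F k f := by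
  simp only [weightedEnergy, Finset.mul_sum]
  refine Finset.sum_congr rfl fun e _ => ?_
  rw [← intervalIntegral.integral_const_mul]
  refine intervalIntegral.integral_congr fun t _ => ?_
  simp only [deriv_const_mul_field]
  ring

theorem weightedEnergy_const_mul_left (c : ℝ) :
    Γ.weightedEnergy F (fun x => c * k x) f = c * Γ.weightedEnergy F k f := by
  rw [weightedEnergy_comm, weightedEnergy_const_mul_right, weightedEnergy_comm]

theorem weightedEnergy_add_weight (hF : Γ.EdgeContinuous F) (hG : Γ.EdgeContinuous G)
    (hk : Γ.Regular k) (hf : Γ.Regular f) : Γ.weightedEnergy (fun x => F x + G x) k f =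
      Γ.weightedEnergy F k f + Γ.weightedEnergy G k f := by
  simp only [weightedEnergy, ← Finset.sum_add_distrib]
  refine Finset.sum_congr rfl fun e _ => ?_
  rw [← intervalIntegral.integral_add
    (RegularOn.intervalIntegrable_weighted (hF e) (hk e) (hf e) (Γ.len_pos e).le)
    (RegularOn.intervalIntegrable_weighted (hG e) (hk e) (hf e) (Γ.len_pos e).le)]
  simp only [add_mul]

theorem weightedEnergy_const_mul_weight (c : ℝ) :
    Γ.weightedEnergy (fun x => c * F x) k f = c * Γ.weightedEnergy F k f := by
  simp only [weightedEnergy, Finset.mul_sum, mul_assoc, intervalIntegral.integral_const_mul]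

theorem energy_add_right (hk : Γ.Regular k) (hf : Γ.Regular f) (hg : Γ.Regular g) :
    Γ.energy k (fun x => f x + g x) = Γ.energy k f + Γ.energy k g :=
  weightedEnergy_add_right (EdgeContinuous.const 1) hk hf hg

theorem energy_const_mul_right (c : ℝ) : Γ.energy k (fun x => c * f x) = c * Γ.energy k f :=
  weightedEnergy_const_mul_right c

theorem energy_add_const_right (c : ℝ) : Γ.energy k (fun x => f x + c) = Γ.energy k f := by
  simp [energy, weightedEnergy]

theorem energy_linear_right (c d : ℝ) (hk : Γ.Regular k) (hf : Γ.Regular f) (hg : Γ.Regular g) :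
    Γ.energy k (fun x => c * f x + d * g x) = c * Γ.energy k f + d * Γ.energy k g := by
  rw [energy_add_right hk (hf.const_mul c) (hg.const_mul d), energy_const_mul_right,
    energy_const_mul_right]

theorem edge_energy_nonneg (f : X → ℝ) (e : E) : 0 ≤ ∫ t in (0 : ℝ)..Γ.len e, (1 : ℝ) *
    (deriv (fun s => f (Γ.param e s)) t * deriv (fun s => f (Γ.param e s)) t) :=
  intervalIntegral.integral_nonneg (Γ.len_pos e).le fun t _ => by
    rw [one_mul]; exact mul_self_nonneg _

theorem energy_self_nonneg (f : X → ℝ) : 0 ≤ Γ.energy f f :=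
  Finset.sum_nonneg fun e _ => edge_energy_nonneg f e

/-- If `f` is constant on every segment then it is constant. -/
theorem eq_of_edge_eq (h : ∀ e, ∀ s ∈ Icc 0 (Γ.len e), ∀ t ∈ Icc 0 (Γ.len e),
    f (Γ.param e s) = f (Γ.param e t)) (x y : X) : f x = f y := by
  induction Γ.connected x y with
  | refl => rfl
  | tail _ hbc ih =>
    obtain ⟨e, s, hs, t, ht, rfl, rfl⟩ := hbc
    exact ih.trans (h e s hs t ht)

/-- Zero energy forces the derivative to vanish almost everywhere on each segment, and connectedness
does the rest. Uniqueness of potentials and nondegeneracy in the Riesz argument both come from here.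
-/
theorem eq_of_energy_eq_zero (hf : Γ.Regular f) (h : Γ.energy f f = 0) (x y : X) : f x = f y := by
  refine eq_of_edge_eq (Γ := Γ) (fun e => ?_) x y
  have h0 := (Finset.sum_eq_zero_iff_of_nonneg fun e _ => edge_energy_nonneg f e).1 h e
    (Finset.mem_univ e)
  have hi := RegularOn.intervalIntegrable_weighted (F := fun _ => 1) continuousOn_const (hf e)
    (hf e) (Γ.len_pos e).le
  rw [intervalIntegral.integral_eq_zero_iff_of_le_of_nonneg_ae (Γ.len_pos e).le
    (Eventually.of_forall fun t => by simpa using mul_self_nonneg _) hi] at h0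
  have key : ∀ s ∈ Icc 0 (Γ.len e), f (Γ.param e s) = f (Γ.param e 0) := by
    intro s hs
    rw [← sub_eq_zero, ← ((hf e).mono le_rfl hs.2).integral_deriv hs.1,
      intervalIntegral.integral_of_le hs.1]
    refine integral_eq_zero_of_ae ?_
    filter_upwards [ae_restrict_of_ae_restrict_of_subset (Ioc_subset_Ioc_right hs.2) h0] with t ht
    simpa using ht
  intro s hs t ht
  rw [key s hs, key t ht]

end energy

/-! ### Weak potentials, vertex sets and Green's identity on the graph -/

variable (Γ)

/-- `Δf = δ_y - δ_z` in the weak sense. -/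
def IsPotential (y z : X) (f : X → ℝ) : Prop :=
  Γ.Regular f ∧ ∀ h, Γ.Regular h → Γ.energy h f = h y - h z

def PiecewiseAffine (V : Set X) (f : X → ℝ) : Prop :=
  Γ.EdgeContinuous f ∧ ∀ e, ∀ t ∈ Ioo 0 (Γ.len e), Γ.param e t ∉ V →
    LocallyAffineAt (fun s => f (Γ.param e s)) t

variable {Γ}

theorem IsVertexSet.zero_mem {V : Set X} (hV : Γ.IsVertexSet V) (e : E) : Γ.param e 0 ∈ V := by
  by_contra h
  obtain ⟨a, ha, hf⟩ := hV.2 _ h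
  have : (e, (0 : ℝ)) ∈ Γ.fiber (Γ.param e 0) := ⟨⟨le_rfl, (Γ.len_pos e).le⟩, rfl⟩
  rw [hf] at this
  rw [← (mem_singleton_iff.1 this)] at ha
  exact lt_irrefl _ ha.1

theorem IsVertexSet.len_mem {V : Set X} (hV : Γ.IsVertexSet V) (e : E) :
    Γ.param e (Γ.len e) ∈ V := by
  by_contra h
  obtain ⟨a, ha, hf⟩ := hV.2 _ h
  have : (e, Γ.len e) ∈ Γ.fiber (Γ.param e (Γ.len e)) := ⟨⟨(Γ.len_pos e).le, le_rfl⟩, rfl⟩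
  rw [hf] at this
  rw [← (mem_singleton_iff.1 this)] at ha
  exact lt_irrefl _ ha.2

theorem IsVertexSet.mono {V W : Set X} (hV : Γ.IsVertexSet V) (hVW : V ⊆ W) (hW : W.Finite) :
    Γ.IsVertexSet W := ⟨hW, fun x hx => hV.2 x fun h => hx (hVW h)⟩

-- The glued points together with all end points of segments suffice.
variable (Γ) in
theorem exists_isVertexSet : ∃ V : Set X, Γ.IsVertexSet V := by
  refine ⟨(fun a : E × ℝ => Γ.param a.1 a.2) '' ({a : E × ℝ | a.2 ∈ Icc 0 (Γ.len a.1) ∧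
    ∃ b : E × ℝ, b ≠ a ∧ b.2 ∈ Icc 0 (Γ.len b.1) ∧ Γ.param b.1 b.2 = Γ.param a.1 a.2} ∪
    (range (fun e => (e, (0 : ℝ))) ∪ range (fun e => (e, Γ.len e)))), ?_, ?_⟩
  · exact (Γ.finite_glued.union ((finite_range _).union (finite_range _))).image _
  · intro x hx
    obtain ⟨e, t, ht, rfl⟩ := Γ.covers x
    have h0 : t ≠ 0 := fun h => hx ⟨(e, t), Or.inr (Or.inl ⟨e, by rw [h]⟩), rfl⟩
    have h1 : t ≠ Γ.len e := fun h => hx ⟨(e, t), Or.inr (Or.inr ⟨e, by rw [h]⟩), rfl⟩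
    refine ⟨(e, t), ⟨ht.1.lt_of_ne' h0, ht.2.lt_of_ne h1⟩, ?_⟩
    refine Subset.antisymm (fun b hb => ?_) ?_
    · by_contra hne
      exact hx ⟨(e, t), Or.inl ⟨ht, b, hne, hb⟩, rfl⟩
    · rintro _ rfl
      exact ⟨ht, rfl⟩

theorem IsVertexSet.finite_positions {V : Set X} (hV : Γ.IsVertexSet V) (e : E) :
    {t | t ∈ Icc 0 (Γ.len e) ∧ Γ.param e t ∈ V}.Finite := by
  have h := (hV.1.biUnion fun x _ => Γ.fiber_finite x).image Prod.snd
  refine h.subset fun t ht => ⟨(e, t), ?_, rfl⟩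
  simp only [mem_iUnion]
  exact ⟨_, ht.2, ht.1, rfl⟩

/-- The positions on the segment `e` that represent points of `V`. -/
def IsVertexSet.positions {V : Set X} (hV : Γ.IsVertexSet V) (e : E) : Finset ℝ :=
  (hV.finite_positions e).toFinset

theorem IsVertexSet.mem_positions {V : Set X} (hV : Γ.IsVertexSet V) {e : E} {t : ℝ} :
    t ∈ hV.positions e ↔ t ∈ Icc 0 (Γ.len e) ∧ Γ.param e t ∈ V := by
  simp only [positions, Set.Finite.mem_toFinset, mem_ofPred_eq]

namespace PiecewiseAffine

variable {V : Set X} {f g : X → ℝ}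

theorem const (c : ℝ) : Γ.PiecewiseAffine V fun _ => c :=
  ⟨EdgeContinuous.const c, fun _ _ _ _ => LocallyAffineAt.const c⟩

theorem add (hf : Γ.PiecewiseAffine V f) (hg : Γ.PiecewiseAffine V g) :
    Γ.PiecewiseAffine V fun x => f x + g x :=
  ⟨hf.1.add hg.1, fun e t ht h => (hf.2 e t ht h).add (hg.2 e t ht h)⟩

theorem const_mul (c : ℝ) (hf : Γ.PiecewiseAffine V f) : Γ.PiecewiseAffine V fun x => c * f x :=
  ⟨(EdgeContinuous.const c).mul hf.1, fun e t ht h => (hf.2 e t ht h).const_mul c⟩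

theorem locallyAffineAt (hV : Γ.IsVertexSet V) (hf : Γ.PiecewiseAffine V f) (e : E) :
    ∀ t ∈ Ioo 0 (Γ.len e), t ∉ hV.positions e → LocallyAffineAt (fun s => f (Γ.param e s)) t :=
  fun t ht h => hf.2 e t ht fun h' => h (hV.mem_positions.2 ⟨Ioo_subset_Icc_self ht, h'⟩)

theorem regular (hV : Γ.IsVertexSet V) (hf : Γ.PiecewiseAffine V f) : Γ.Regular f := fun e =>
  regularOn_of_locallyAffineAt (S := hV.positions e)
    (hV.mem_positions.2 ⟨⟨le_rfl, (Γ.len_pos e).le⟩, hV.zero_mem e⟩)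
    (hV.mem_positions.2 ⟨⟨(Γ.len_pos e).le, le_rfl⟩, hV.len_mem e⟩) (hf.1 e)
    (hf.locallyAffineAt hV e)

/-- Green's identity. -/
theorem energy_eq_sum (hV : Γ.IsVertexSet V) (hf : Γ.PiecewiseAffine V f) {h : X → ℝ}
    (hh : Γ.Regular h) : Γ.energy h f = -∑ x ∈ hV.1.toFinset, h x * Γ.slopeSum f x := by
  classical
  set D : E × ℝ → ℝ := fun a =>
    derivWithin (fun t => f (Γ.param a.1 t)) (Icc a.2 (Γ.len a.1)) a.2
      - derivWithin (fun t => f (Γ.param a.1 t)) (Icc 0 a.2) a.2 with hD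
  have h1 : ∀ x, h x * Γ.slopeSum f x =
      ∑ a ∈ (Γ.fiber_finite x).toFinset, h (Γ.param a.1 a.2) * D a := by
    intro x
    rw [slopeSum, finsum_mem_eq_finite_toFinset_sum _ (Γ.fiber_finite x), Finset.mul_sum]
    refine Finset.sum_congr rfl fun a ha => ?_
    rw [Set.Finite.mem_toFinset] at ha
    rw [ha.2]
  -- The fibers over `V` are disjoint and together consist of all positions of vertices, so the sum
  -- can be regrouped by segments.
  have h2 : ∑ x ∈ hV.1.toFinset, h x * Γ.slopeSum f x =
      ∑ e, ∑ t ∈ hV.positions e, h (Γ.param e t) * D (e, t) := by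
    rw [Finset.sum_congr rfl fun x _ => h1 x, ← Finset.sum_biUnion]
    · refine Finset.sum_finset_product _ _ _ fun a => ?_
      simp only [Finset.mem_biUnion, Set.Finite.mem_toFinset, Finset.mem_univ, true_and,
        hV.mem_positions, fiber, mem_ofPred_eq]
      constructor
      · rintro ⟨x, hx, ha, rfl⟩
        exact ⟨ha, hx⟩
      · rintro ⟨ha, hx⟩
        exact ⟨_, hx, ha, rfl⟩
    · intro x _ y _ hxy
      rw [Function.onFun, Finset.disjoint_left]
      intro a ha hb
      rw [Set.Finite.mem_toFinset] at ha hb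
      exact hxy (ha.2.symm.trans hb.2)
  rw [h2, energy, weightedEnergy, ← Finset.sum_neg_distrib]
  refine Finset.sum_congr rfl fun e _ => ?_
  simp only [one_mul]
  exact integral_deriv_mul_deriv_eq_sum (Γ.len_pos e) (fun s hs => (hV.mem_positions.1 hs).1)
    (hV.mem_positions.2 ⟨⟨le_rfl, (Γ.len_pos e).le⟩, hV.zero_mem e⟩)
    (hV.mem_positions.2 ⟨⟨(Γ.len_pos e).le, le_rfl⟩, hV.len_mem e⟩) (hf.1 e)
    (hf.locallyAffineAt hV e) (hh e)

/-- Off `V` the fiber is a single interior position, where the forward and backward slopes cancel.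
-/
theorem slopeSum_eq_zero (hV : Γ.IsVertexSet V) (hf : Γ.PiecewiseAffine V f) {x : X}
    (hx : x ∉ V) : Γ.slopeSum f x = 0 := by
  obtain ⟨⟨e, t⟩, ht, hfib⟩ := hV.2 x hx
  have hmem : (e, t) ∈ Γ.fiber x := hfib ▸ mem_singleton _
  obtain ⟨c, d, hcd⟩ := hf.2 e t ht (by rw [hmem.2]; exact hx)
  have hd := (hasDerivAt_affine c d t).congr_of_eventuallyEq hcd
  rw [slopeSum, hfib, finsum_mem_singleton]
  rw [hd.hasDerivWithinAt.derivWithin (uniqueDiffOn_Icc ht.2 t ⟨le_rfl, ht.2.le⟩),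
    hd.hasDerivWithinAt.derivWithin (uniqueDiffOn_Icc ht.1 t ⟨ht.1.le, le_rfl⟩), sub_self]

/-- Green's identity writes the energy of `f` as a sum over `V` in which every term has a factor `f
x = 0`. -/
theorem eq_zero_of_eq_zero_on (hV : Γ.IsVertexSet V) (hf : Γ.PiecewiseAffine V f)
    (h : ∀ x ∈ V, f x = 0) (x : X) : f x = 0 := by
  have he : Γ.energy f f = 0 := by
    rw [hf.energy_eq_sum hV (hf.regular hV), Finset.sum_eq_zero, neg_zero]
    intro y hy
    rw [h y (hV.1.mem_toFinset.1 hy), zero_mul]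
  obtain ⟨e, t, ht, rfl⟩ := Γ.covers x
  rw [eq_of_energy_eq_zero (hf.regular hV) he _ (Γ.param e 0), h _ (hV.zero_mem e)]

theorem zh (hV : Γ.IsVertexSet V) (hf : Γ.PiecewiseAffine V f) : Γ.Zh f ∧
    ∀ e, ∀ᵐ t ∂(volume.restrict (Icc 0 (Γ.len e))), Γ.laplacianDensity f e t = 0 := by
  have key : ∀ e, ∀ᵐ t ∂(volume.restrict (Icc 0 (Γ.len e))),
      deriv (deriv (fun s => f (Γ.param e s))) t = 0 := by
    intro e
    filter_upwards [ae_restrict_mem measurableSet_Icc,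
      ae_restrict_of_ae ((hV.positions e).finite_toSet.countable.ae_notMem volume)] with t ht hn
    have h0 : t ≠ 0 := by
      rintro rfl
      exact hn (hV.mem_positions.2 ⟨ht, hV.zero_mem e⟩)
    have h1 : t ≠ Γ.len e := by
      rintro rfl
      exact hn (hV.mem_positions.2 ⟨ht, hV.len_mem e⟩)
    exact (hf.locallyAffineAt hV e t ⟨ht.1.lt_of_ne' h0, ht.2.lt_of_ne h1⟩
      hn).hasDerivAt_deriv.2.deriv
  refine ⟨⟨hf.1, ⟨V, hV, fun e t ht => ((hf.2 e t ht.1 ht.2).contDiffAt).contDiffWithinAt⟩,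
    fun e => ?_⟩, fun e => ?_⟩
  · exact (integrable_zero ℝ ℝ _).congr (by filter_upwards [key e] with t ht using ht.symm)
  · filter_upwards [key e] with t ht
    rw [laplacianDensity, ht, neg_zero]

end PiecewiseAffine

theorem exists_piecewiseAffine_interpolating {V : Set X} (hV : Γ.IsVertexSet V) (φ : X → ℝ) :
    ∃ f, Γ.PiecewiseAffine V f ∧ ∀ x ∈ V, f x = φ x := by
  classical
  choose c k hck using fun e => exists_hinge_interpolating (hV.positions e)
    fun t => φ (Γ.param e t)
  choose e t ht hp using Γ.covers
  set f : X → ℝ := fun x => if x ∈ V then φ x else hinge (hV.positions (e x)) (c (e x)) (k (e x))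
    (t x) with hf
  have key : ∀ i, ∀ s ∈ Icc 0 (Γ.len i),
      f (Γ.param i s) = hinge (hV.positions i) (c i) (k i) s := by
    intro i s hs
    by_cases h : Γ.param i s ∈ V
    · simp only [hf, if_pos h]
      exact (hck i s (hV.mem_positions.2 ⟨hs, h⟩)).symm
    · simp only [hf, if_neg h]
      -- A non-vertex has only one position, so the position chosen to define `f` there is `(i, s)`
      -- itself.
      obtain ⟨a, -, hfib⟩ := hV.2 _ h
      have h1 : (i, s) ∈ Γ.fiber (Γ.param i s) := ⟨hs, rfl⟩
      have h2 : (e (Γ.param i s), t (Γ.param i s)) ∈ Γ.fiber (Γ.param i s) := ⟨ht _, hp _⟩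
      rw [hfib, mem_singleton_iff] at h1 h2
      obtain ⟨h3, h4⟩ := Prod.ext_iff.1 (h2.trans h1.symm)
      dsimp only at h3 h4
      rw [h4, h3]
  refine ⟨f, ⟨fun i => ((continuous_hinge _ _ _).continuousOn).congr (key i), fun i s hs h => ?_⟩,
    fun x hx => by simp only [hf, if_pos hx]⟩
  refine (hinge_locallyAffineAt (hV.positions i) (c i) (k i)
    fun h' => h (hV.mem_positions.1 h').2).congr ?_
  filter_upwards [Icc_mem_nhds hs.1 hs.2] with r hr using key i r hr

/-- Off a vertex set the second derivative is continuous and zero almost everywhere, hence zero.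
Adjoining `y` and `z` to the vertex set places the masses of `δ_y - δ_z` on vertices. -/
theorem LaplacianEqDiracSub.piecewiseAffine {f : X → ℝ} {y z : X}
    (h : Γ.LaplacianEqDiracSub f y z) :
    ∃ V, Γ.IsVertexSet V ∧ y ∈ V ∧ z ∈ V ∧ Γ.PiecewiseAffine V f := by
  obtain ⟨⟨hc, ⟨V, hV, hC⟩, -⟩, hd, -⟩ := h
  have hVW : V ⊆ insert y (insert z V) := (subset_insert _ _).trans (subset_insert _ _)
  refine ⟨insert y (insert z V), hV.mono hVW ((hV.1.insert z).insert y), by simp, by simp, hc,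
    fun e t ht htV => ?_⟩
  set u := fun s => f (Γ.param e s) with hu
  set O := {t ∈ Ioo 0 (Γ.len e) | Γ.param e t ∉ V} with hO
  have hOeq : O = Ioo 0 (Γ.len e) \ (hV.positions e : Set ℝ) := by
    ext s
    simp only [hO, mem_ofPred_eq, Set.mem_sdiff, Finset.mem_coe, hV.mem_positions]
    exact ⟨fun h => ⟨h.1, fun h' => h.2 h'.2⟩, fun h => ⟨h.1, fun h' =>
      h.2 ⟨Ioo_subset_Icc_self h.1, h'⟩⟩⟩
  have hOo : IsOpen O := by
    rw [hOeq]
    exact isOpen_Ioo.sdiff (hV.positions e).finite_toSet.isClosed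
  have hcd : ContDiffOn ℝ 2 u O := hC e
  have h1 : ContDiffOn ℝ 1 (deriv u) O := hcd.deriv_of_isOpen hOo (by norm_num)
  have h2 : ContinuousOn (deriv (deriv u)) O := (h1.deriv_of_isOpen (m := 0) hOo
    (by norm_num)).continuousOn
  have h3 : EqOn (deriv (deriv u)) (fun _ => 0) O := by
    refine Measure.eqOn_open_of_ae_eq (μ := volume) ?_ hOo h2 continuousOn_const
    have hsub : O ⊆ Icc 0 (Γ.len e) := fun s hs => Ioo_subset_Icc_self hs.1
    filter_upwards [ae_restrict_of_ae_restrict_of_subset hsub (hd e)] with s hs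
    simpa [laplacianDensity] using hs
  obtain ⟨a, b, htab, hab⟩ := mem_nhds_iff_exists_Ioo_subset.1
    (hOo.mem_nhds ⟨ht, fun h => htV (hVW h)⟩)
  obtain ⟨c, d, hcd'⟩ := affine_of_deriv_deriv_eq_zero (u := u) (a := a) (b := b) fun s hs => by
    have hs' := hOo.mem_nhds (hab hs)
    refine ⟨(hcd.differentiableOn (by norm_num)).differentiableAt hs', ?_⟩
    have h4 := ((h1.differentiableOn (by norm_num)).differentiableAt hs').hasDerivAt
    rwa [h3 (hab hs)] at h4
  refine ⟨c, d, ?_⟩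
  filter_upwards [Ioo_mem_nhds htab.1 htab.2] with s hs using hcd' s hs

theorem LaplacianEqDiracSub.isPotential {f : X → ℝ} {y z : X}
    (h : Γ.LaplacianEqDiracSub f y z) : Γ.IsPotential y z f := by
  classical
  obtain ⟨V, hV, hy, hz, hf⟩ := h.piecewiseAffine
  refine ⟨hf.regular hV, fun k hk => ?_⟩
  rw [hf.energy_eq_sum hV hk, ← Finset.sum_neg_distrib]
  have h1 : ∀ x, -(k x * Γ.slopeSum f x) =
      (if x = y then k x else 0) - (if x = z then k x else 0) := by
    intro x
    have := h.2.2 x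
    rw [laplacianAtom] at this
    rw [← mul_neg, this, mul_sub]
    simp [indicator_apply]
  simp only [h1, Finset.sum_sub_distrib]
  rw [Finset.sum_ite_eq' , Finset.sum_ite_eq', if_pos (hV.1.mem_toFinset.2 hy),
    if_pos (hV.1.mem_toFinset.2 hz)]

/-! ### Existence and uniqueness of the voltage function -/

variable (Γ) in
/-- The piecewise affine functions with break points in `V` that vanish at `z`. -/
def affineSubmodule (V : Set X) (z : X) : Submodule ℝ (X → ℝ) where
  carrier := {f | Γ.PiecewiseAffine V f ∧ f z = 0}
  add_mem' := fun hf hg => ⟨hf.1.add hg.1, by simp [hf.2, hg.2]⟩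
  zero_mem' := ⟨PiecewiseAffine.const 0, rfl⟩
  smul_mem' := fun c _ hf => ⟨hf.1.const_mul c, by simp [hf.2]⟩

theorem finiteDimensional_affineSubmodule {V : Set X} (hV : Γ.IsVertexSet V) (z : X) :
    FiniteDimensional ℝ (Γ.affineSubmodule V z) := by
  have := hV.1.to_subtype
  let ev : Γ.affineSubmodule V z →ₗ[ℝ] (V → ℝ) :=
    (LinearMap.funLeft ℝ ℝ (Subtype.val : V → X)).comp (Submodule.subtype _)
  refine FiniteDimensional.of_injective ev ?_
  rw [← LinearMap.ker_eq_bot, LinearMap.ker_eq_bot']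
  intro f hf
  ext x
  exact f.2.1.eq_zero_of_eq_zero_on hV (fun x hx => congrFun hf ⟨x, hx⟩) x

/-- The Riesz representation of evaluation at `y` with respect to the Dirichlet form. -/
theorem exists_representing {V : Set X} (hV : Γ.IsVertexSet V) (y z : X) :
    ∃ g, Γ.PiecewiseAffine V g ∧ g z = 0 ∧
      ∀ k, Γ.PiecewiseAffine V k → Γ.energy k g = k y - k z := by
  have := finiteDimensional_affineSubmodule hV z
  have hr : ∀ f : Γ.affineSubmodule V z, Γ.Regular f.1 := fun f => f.2.1.regular hV
  let B : Γ.affineSubmodule V z →ₗ[ℝ] Module.Dual ℝ (Γ.affineSubmodule V z) :=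
    LinearMap.mk₂ ℝ (fun f k => Γ.energy k.1 f.1)
      (fun f g k => energy_add_right (hr k) (hr f) (hr g))
      (fun c f k => energy_const_mul_right c)
      (fun f g k => by
        simp only [energy_comm _ f.1]
        exact energy_add_right (hr f) (hr g) (hr k))
      (fun c f k => by
        simp only [energy_comm _ f.1]
        exact energy_const_mul_right c)
  have hinj : Function.Injective B := by
    rw [← LinearMap.ker_eq_bot, LinearMap.ker_eq_bot']
    intro f hf
    have h0 : Γ.energy f.1 f.1 = 0 := LinearMap.congr_fun hf f
    ext x
    rw [eq_of_energy_eq_zero (hr f) h0 x z, f.2.2]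
    rfl
  -- A space and its dual have the same finite dimension, so the injective `B` also represents
  -- evaluation at `y`.
  have hsurj := (LinearMap.injective_iff_surjective_of_finrank_eq_finrank
    Subspace.dual_finrank_eq.symm).1 hinj
  obtain ⟨g, hg⟩ := hsurj ((LinearMap.proj y).comp (Submodule.subtype _))
  refine ⟨g.1, g.2.1, g.2.2, fun k hk => ?_⟩
  -- Subtracting `k z` moves `k` into the subspace of functions vanishing at `z` without changing
  -- the energy.
  have hk' : Γ.PiecewiseAffine V (fun x => k x + -k z) := hk.add (PiecewiseAffine.const _)
  have h1 : Γ.energy (fun x => k x + -k z) g.1 = k y + -k z :=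
    LinearMap.congr_fun hg ⟨_, hk', by simp⟩
  rw [energy_comm, energy_add_const_right, energy_comm] at h1
  rw [h1, sub_eq_add_neg]

-- The representing function is tested only against piecewise affine functions, but the one
-- interpolating the indicator of a vertex `x` already isolates the atom at `x`.
variable (Γ) in
theorem exists_laplacianEqDiracSub (y z : X) :
    ∃ f, Γ.LaplacianEqDiracSub f y z ∧ f z = 0 := by
  classical
  obtain ⟨V₀, hV₀⟩ := Γ.exists_isVertexSet
  set V := insert y (insert z V₀) with hVdef
  have hV : Γ.IsVertexSet V := hV₀.mono ((subset_insert _ _).trans (subset_insert _ _))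
    ((hV₀.1.insert z).insert y)
  have hy : y ∈ V := by simp [hVdef]
  have hz : z ∈ V := by simp [hVdef]
  obtain ⟨g, hg, hgz, hrep⟩ := exists_representing hV y z
  obtain ⟨h1, h2⟩ := hg.zh hV
  refine ⟨g, ⟨h1, h2, fun x => ?_⟩, hgz⟩
  rw [laplacianAtom]
  by_cases hx : x ∈ V
  · obtain ⟨k, hk, hkV⟩ := exists_piecewiseAffine_interpolating hV (Pi.single x 1)
    have h3 := hg.energy_eq_sum hV (hk.regular hV)
    rw [hrep k hk, hkV y hy, hkV z hz, Finset.sum_eq_single x, hkV x hx, Pi.single_eq_same,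
      one_mul] at h3
    · rw [← h3]
      simp [Pi.single_apply, indicator_apply, eq_comm]
    · intro b hb hbx
      rw [hkV b (hV.1.mem_toFinset.1 hb), Pi.single_eq_of_ne hbx, zero_mul]
    · exact fun h => absurd (hV.1.mem_toFinset.2 hx) h
  · have hxy : x ≠ y := fun h => hx (h ▸ hy)
    have hxz : x ≠ z := fun h => hx (h ▸ hz)
    simp [hg.slopeSum_eq_zero hV hx, hxy, hxz]

/-- By existence, `voltage` never takes its default branch. -/
theorem voltage_spec (z y : X) :
    Γ.LaplacianEqDiracSub (fun x => Γ.voltage z x y) y z ∧ Γ.voltage z z y = 0 := by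
  have h := Γ.exists_laplacianEqDiracSub y z
  have e : (fun x => Γ.voltage z x y) = h.choose := by
    funext x
    rw [voltage, dif_pos h]
  have e' : Γ.voltage z z y = h.choose z := congrFun e z
  rw [e, e']
  exact h.choose_spec

theorem isPotential_voltage (z y : X) : Γ.IsPotential y z fun x => Γ.voltage z x y :=
  (voltage_spec z y).1.isPotential

@[simp]
theorem voltage_self (z y : X) : Γ.voltage z z y = 0 := (voltage_spec z y).2

/-- The difference of two potentials, used as its own test function, has zero energy. -/
theorem IsPotential.sub_eq {y z : X} {f g : X → ℝ} (hf : Γ.IsPotential y z f)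
    (hg : Γ.IsPotential y z g) (a b : X) : f a - f b = g a - g b := by
  have hr := hf.1.linear 1 (-1) hg.1
  have h0 : Γ.energy (fun x => 1 * f x + -1 * g x) (fun x => 1 * f x + -1 * g x) = 0 := by
    rw [energy_linear_right 1 (-1) hr hf.1 hg.1, hf.2 _ hr, hg.2 _ hr]
    ring
  have := eq_of_energy_eq_zero hr h0 a b
  linarith

theorem IsPotential.voltage_eq {y z : X} {f : X → ℝ} (hf : Γ.IsPotential y z f) (x : X) :
    Γ.voltage z x y = f x - f z := by
  have := hf.sub_eq (isPotential_voltage z y) x z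
  rw [voltage_self] at this
  linarith

end MetrizedGraph

/-! ### Reciprocity, and continuity of the voltage in its base point -/

namespace MetrizedGraph

variable {X E : Type*} [Fintype E] {Γ : MetrizedGraph X E}

/-- Reciprocity: the Dirichlet form is symmetric. -/
theorem IsPotential.reciprocity {y z y' z' : X} {f g : X → ℝ} (hf : Γ.IsPotential y z f)
    (hg : Γ.IsPotential y' z' g) : f y' - f z' = g y - g z := by
  rw [← hg.2 f hf.1, ← hf.2 g hg.1, energy_comm]

theorem energy_voltage_self (p x : X) :
    Γ.energy (fun y => Γ.voltage p y x) (fun y => Γ.voltage p y x) = Γ.voltage p x x := by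
  rw [(isPotential_voltage p x).2 _ (isPotential_voltage p x).1, voltage_self, sub_zero]

theorem voltage_nonneg_diag (p x : X) : 0 ≤ Γ.voltage p x x := by
  rw [← energy_voltage_self]
  exact energy_self_nonneg _

/-- The resistance is the energy of `j_p(·, q)`. If it vanished, this function would be constant,
with no atom at `q`. -/
theorem resistance_pos {p q : X} (hpq : p ≠ q) : 0 < Γ.resistance p q := by
  refine (voltage_nonneg_diag p q).lt_of_ne' fun h => ?_
  have hc := eq_of_energy_eq_zero (isPotential_voltage p q).1 ((energy_voltage_self p q).trans h)
  have h1 := (voltage_spec (Γ := Γ) p q).1.2.2 q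
  have h2 : (fun x => Γ.voltage p x q) = fun _ => Γ.voltage p p q := funext fun x => hc x p
  rw [h2] at h1
  simp [laplacianAtom, slopeSum, hpq.symm] at h1

theorem voltage_symm (p x y : X) : Γ.voltage p y x = Γ.voltage p x y := by
  simpa using (isPotential_voltage p x).reciprocity (isPotential_voltage p y)

theorem isPotential_voltage_sub (p x q : X) :
    Γ.IsPotential q x fun y => 1 * Γ.voltage p y q + -1 * Γ.voltage p y x := by
  have hq := isPotential_voltage (Γ := Γ) p q
  have hx := isPotential_voltage (Γ := Γ) p x
  refine ⟨hq.1.linear _ _ hx.1, fun h hh => ?_⟩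
  rw [energy_linear_right _ _ hh hq.1 hx.1, hq.2 h hh, hx.2 h hh]
  ring

/-- This trades the moving base point `x` for the fixed base point `p`, reducing continuity in `x`
to that of `r(p, x)`. -/
theorem voltage_eq_diag_sub (x p q : X) :
    Γ.voltage x p q = Γ.voltage p x x - Γ.voltage p x q := by
  rw [(isPotential_voltage_sub p x q).voltage_eq]
  simp [sub_eq_add_neg]

/-- Cauchy–Schwarz with a free parameter `ε` in place of square roots: with `σ = ±1` the sign of the
difference, integrate `(ε f' - σ)² / ε ≥ 0` over `[s, t]`. -/
theorem edge_difference_le {f : X → ℝ} (hf : Γ.Regular f) (e : E) {s t ε : ℝ} (hε : 0 < ε)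
    (hs : s ∈ Icc 0 (Γ.len e)) (ht : t ∈ Icc 0 (Γ.len e)) (hst : s ≤ t) :
    2 * |f (Γ.param e t) - f (Γ.param e s)| ≤ ε * Γ.energy f f + (t - s) / ε := by
  have hr : RegularOn (fun r => f (Γ.param e r)) s t := (hf e).mono hs.1 ht.2
  have hi1 := hr.intervalIntegrable_deriv hst
  have hi2 := RegularOn.intervalIntegrable_weighted (F := fun _ => 1) continuousOn_const hr hr hst
  have hi3 := RegularOn.intervalIntegrable_weighted (F := fun _ => 1) continuousOn_const (hf e)
    (hf e) (Γ.len_pos e).le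
  have h1 : ∫ r in s..t, (1 : ℝ) * (deriv (fun r => f (Γ.param e r)) r *
      deriv (fun r => f (Γ.param e r)) r) ≤ Γ.energy f f := by
    refine le_trans ?_ (Finset.single_le_sum (fun e _ => edge_energy_nonneg f e)
      (Finset.mem_univ e))
    refine intervalIntegral.integral_mono_interval hs.1 hst ht.2
      (Eventually.of_forall fun r => ?_) hi3
    simpa using mul_self_nonneg _
  have key : ∀ σ : ℝ, σ * σ = 1 →
      2 * (σ * (f (Γ.param e t) - f (Γ.param e s))) ≤ ε * Γ.energy f f + (t - s) / ε := by
    intro σ hσ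
    have h2 : (t - s) / ε = ∫ _ in s..t, 1 / ε := by simp [div_eq_mul_inv]
    rw [← hr.integral_deriv hst, h2, ← intervalIntegral.integral_const_mul,
      ← intervalIntegral.integral_const_mul]
    refine le_trans ?_ (add_le_add_left (mul_le_mul_of_nonneg_left h1 hε.le) _)
    rw [← intervalIntegral.integral_const_mul, ← intervalIntegral.integral_add
      (hi2.const_mul ε) intervalIntegrable_const]
    refine intervalIntegral.integral_mono_on hst ((hi1.const_mul σ).const_mul 2)
      ((hi2.const_mul ε).add intervalIntegrable_const) fun r _ => ?_
    set d := deriv (fun r => f (Γ.param e r)) r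
    have h3 : ε * (1 * (d * d)) + 1 / ε - 2 * (σ * d) = (ε * d - σ) ^ 2 / ε := by
      field_simp
      linear_combination (-1 : ℝ) * hσ
    have h4 : 0 ≤ (ε * d - σ) ^ 2 / ε := by positivity
    linarith
  rcases abs_cases (f (Γ.param e t) - f (Γ.param e s)) with ⟨h, -⟩ | ⟨h, -⟩
  · rw [h]; simpa using key 1 (by norm_num)
  · rw [h]; simpa using key (-1) (by norm_num)

/-- Let `R x = j_p(x, x)`. Nonnegative energy of `j_p(·, x) - j_p(·, y)` gives `R y - R x ≤ 2 (R y -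
j_p(x, y))`, and the right side is twice the increment of `j_p(·, y)` along the segment. -/
theorem voltage_diag_difference_le (p : X) (e : E) {s t ε : ℝ} (hε : 0 < ε)
    (hs : s ∈ Icc 0 (Γ.len e)) (ht : t ∈ Icc 0 (Γ.len e)) :
    Γ.voltage p (Γ.param e t) (Γ.param e t) - Γ.voltage p (Γ.param e s) (Γ.param e s) ≤
      ε * Γ.voltage p (Γ.param e t) (Γ.param e t) + |t - s| / ε := by
  set x := Γ.param e s with hx
  set y := Γ.param e t with hy
  have hX := isPotential_voltage (Γ := Γ) p x
  have hY := isPotential_voltage (Γ := Γ) p y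
  have h0 := energy_self_nonneg (Γ := Γ)
    (fun z => 1 * Γ.voltage p z x + -1 * Γ.voltage p z y)
  have hr := hX.1.linear 1 (-1) hY.1
  rw [energy_linear_right _ _ hr hX.1 hY.1, hX.2 _ hr, hY.2 _ hr, voltage_self, voltage_self,
    voltage_symm p x y] at h0
  have h1 : 2 * |Γ.voltage p y y - Γ.voltage p x y| ≤
      ε * Γ.voltage p y y + |t - s| / ε := by
    rw [← energy_voltage_self p y]
    rcases le_total s t with h | h
    · rw [abs_of_nonneg (sub_nonneg.2 h)]
      have := edge_difference_le hY.1 e hε hs ht h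
      rwa [energy_voltage_self] at this ⊢
    · rw [abs_sub_comm t s, abs_of_nonneg (sub_nonneg.2 h), energy_voltage_self, abs_sub_comm]
      have := edge_difference_le hY.1 e hε ht hs h
      rwa [energy_voltage_self] at this
  have h2 := le_abs_self (Γ.voltage p y y - Γ.voltage p x y)
  linarith

theorem edgeContinuous_voltage_diag (p : X) : Γ.EdgeContinuous fun x => Γ.voltage p x x := by
  intro e
  set R : ℝ → ℝ := fun t => Γ.voltage p (Γ.param e t) (Γ.param e t) with hR
  have hR0 : ∀ t, 0 ≤ R t := fun t => voltage_nonneg_diag _ _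
  have hd : ∀ s ∈ Icc 0 (Γ.len e), ∀ t ∈ Icc 0 (Γ.len e), ∀ ε > 0,
      R t - R s ≤ ε * R t + |t - s| / ε :=
    fun s hs t ht ε hε => voltage_diag_difference_le p e hε hs ht
  obtain ⟨M, hM0, hM⟩ : ∃ M, 0 < M ∧ ∀ t ∈ Icc 0 (Γ.len e), R t ≤ M := by
    have hl := Γ.len_pos e
    -- The estimate with `ε = 1 / 2`, starting from position `0`, yields `R t ≤ 2 R 0 + 4 t`.
    refine ⟨2 * R 0 + 4 * Γ.len e, by linarith [hR0 0], fun t ht => ?_⟩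
    have := hd 0 ⟨le_rfl, hl.le⟩ t ht (1 / 2) (by norm_num)
    rw [sub_zero, abs_of_nonneg ht.1] at this
    linarith [ht.2]
  rw [Metric.continuousOn_iff]
  intro s hs η hη
  -- Then `ε * R ≤ η / 4`, while `|t - s| / ε < η / 2` for `t` close to `s`.
  set ε := η / (4 * M) with hε
  have hε0 : 0 < ε := by positivity
  refine ⟨ε * η / 2, by positivity, fun t ht hts => ?_⟩
  rw [Real.dist_eq] at hts ⊢
  have h1 := hd s hs t ht ε hε0
  have h2 := hd t ht s hs ε hε0
  rw [abs_sub_comm s t] at h2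
  have h3 : |t - s| / ε < η / 2 := by
    rw [div_lt_iff₀ hε0]
    linarith
  have h4 : ε * M = η / 4 := by
    rw [hε]; field_simp
  have h5 := mul_le_mul_of_nonneg_left (hM t ht) hε0.le
  have h6 := mul_le_mul_of_nonneg_left (hM s hs) hε0.le
  rw [abs_lt]
  constructor <;> linarith

theorem edgeContinuous_voltage_base (p q : X) : Γ.EdgeContinuous fun x => Γ.voltage x p q := by
  have h := (edgeContinuous_voltage_diag (Γ := Γ) p).add
    ((isPotential_voltage (Γ := Γ) p q).1.const_mul (-1)).edgeContinuous
  convert h using 2 with x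
  rw [voltage_eq_diag_sub]
  ring

theorem A_eq_weightedEnergy (p q : X) : Γ.A p q =
    Γ.weightedEnergy (fun x => Γ.voltage x p q) (fun x => Γ.voltage p x q)
      (fun x => Γ.voltage p x q) := by
  simp only [A, weightedEnergy, sq]

/-- Pushing forward the energy measure of `j_p(·, q)` by `j_p(·, q)` gives Lebesgue measure on
`[0, r(p, q)]`; here against `s (r(p, q) - s)`. -/
theorem weightedEnergy_voltage (p q : X) :
    Γ.weightedEnergy (fun x => Γ.voltage p x q * (Γ.resistance p q - Γ.voltage p x q))
      (fun x => Γ.voltage p x q) (fun x => Γ.voltage p x q) = Γ.resistance p q ^ 3 / 6 := by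
  have hg := isPotential_voltage (Γ := Γ) p q
  set g := fun x => Γ.voltage p x q with hgdef
  set R := Γ.resistance p q with hR
  have hgq : g q = R := rfl
  have hgp : g p = 0 := voltage_self p q
  -- The test function is the antiderivative `R s² / 2 - s³ / 3` of `s (R - s)`, composed with `g`;
  -- its values at `q` and `p` are `R³ / 6` and `0`.
  have hh : Γ.Regular fun x => R / 2 * (g x * g x) + -1 / 3 * (g x * (g x * g x)) :=
    (hg.1.mul hg.1).linear _ _ (hg.1.mul (hg.1.mul hg.1))
  have h1 := hg.2 _ hh
  rw [hgq, hgp] at h1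
  have h2 : Γ.weightedEnergy (fun x => g x * (R - g x)) g g =
      Γ.energy (fun x => R / 2 * (g x * g x) + -1 / 3 * (g x * (g x * g x))) g := by
    refine Finset.sum_congr rfl fun e _ => ?_
    obtain ⟨S, hS, hd⟩ := (hg.1 e).exists_finite_hasDerivAt
    refine integral_congr_off_finite (Γ.len_pos e).le hS fun t ht => ?_
    have hd := hd t ht
    have h3 := ((hd.fun_mul hd).const_mul (R / 2)).fun_add
      ((hd.fun_mul (hd.fun_mul hd)).const_mul (-1 / 3))
    dsimp only
    rw [h3.deriv]
    ring
  rw [h2, h1]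
  ring

end MetrizedGraph

/-! ### Unions along two points -/

namespace MetrizedGraph

/-- `Γ` is the union of `Γ₁` and `Γ₂` along two points, in terms of the induced functions. -/
structure IsTwoPointUnion {X X₁ X₂ E E₁ E₂ : Type*} [Fintype E] [Fintype E₁] [Fintype E₂]
    (Γ : MetrizedGraph X E) (Γ₁ : MetrizedGraph X₁ E₁) (Γ₂ : MetrizedGraph X₂ E₂)
    (i₁ : X₁ → X) (i₂ : X₂ → X) (p₁ q₁ : X₁) (p₂ q₂ : X₂) : Prop where
  map_p : i₁ p₁ = i₂ p₂
  map_q : i₁ q₁ = i₂ q₂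
  regular_iff : ∀ f : X → ℝ, Γ.Regular f ↔ Γ₁.Regular (f ∘ i₁) ∧ Γ₂.Regular (f ∘ i₂)
  weightedEnergy_eq : ∀ F k f : X → ℝ, Γ.EdgeContinuous F → Γ.Regular k → Γ.Regular f →
    Γ.weightedEnergy F k f = Γ₁.weightedEnergy (F ∘ i₁) (k ∘ i₁) (f ∘ i₁) +
      Γ₂.weightedEnergy (F ∘ i₂) (k ∘ i₂) (f ∘ i₂)
  exists_extension : ∀ (f₁ : X₁ → ℝ) (f₂ : X₂ → ℝ), f₁ p₁ = f₂ p₂ → f₁ q₁ = f₂ q₂ →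
    ∃ f : X → ℝ, f ∘ i₁ = f₁ ∧ f ∘ i₂ = f₂

namespace IsTwoPointUnion

variable {X X₁ X₂ E E₁ E₂ : Type*} [Fintype E] [Fintype E₁] [Fintype E₂]
  {Γ : MetrizedGraph X E} {Γ₁ : MetrizedGraph X₁ E₁} {Γ₂ : MetrizedGraph X₂ E₂}
  {i₁ : X₁ → X} {i₂ : X₂ → X} {p₁ q₁ : X₁} {p₂ q₂ : X₂}

theorem symm (h : IsTwoPointUnion Γ Γ₁ Γ₂ i₁ i₂ p₁ q₁ p₂ q₂) :
    IsTwoPointUnion Γ Γ₂ Γ₁ i₂ i₁ p₂ q₂ p₁ q₁ where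
  map_p := h.map_p.symm
  map_q := h.map_q.symm
  regular_iff f := (h.regular_iff f).trans and_comm
  weightedEnergy_eq F k f hF hk hf := (h.weightedEnergy_eq F k f hF hk hf).trans (add_comm _ _)
  exists_extension f₁ f₂ hp hq :=
    (h.exists_extension f₂ f₁ hp.symm hq.symm).imp fun _ hf => hf.symm

theorem energy_eq (h : IsTwoPointUnion Γ Γ₁ Γ₂ i₁ i₂ p₁ q₁ p₂ q₂) {k f : X → ℝ}
    (hk : Γ.Regular k) (hf : Γ.Regular f) : Γ.energy k f =
      Γ₁.energy (k ∘ i₁) (f ∘ i₁) + Γ₂.energy (k ∘ i₂) (f ∘ i₂) :=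
  h.weightedEnergy_eq _ k f (EdgeContinuous.const 1) hk hf

/-- A potential on `Γ₁` with an additional current `α` from `p` to `q` through `Γ₁`, returning
through `Γ₂`, is a potential on the union as soon as the potential drops agree. -/
theorem exists_isPotential (h : IsTwoPointUnion Γ Γ₁ Γ₂ i₁ i₂ p₁ q₁ p₂ q₂) {f₁ : X₁ → ℝ}
    {y z : X₁} (hf : Γ₁.IsPotential y z f₁) {α : ℝ}
    (hα : f₁ q₁ - f₁ p₁ + α * Γ₁.resistance p₁ q₁ = -α * Γ₂.resistance p₂ q₂) :
    ∃ f, Γ.IsPotential (i₁ y) (i₁ z) f ∧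
      ∀ x, f (i₁ x) = 1 * f₁ x + α * Γ₁.voltage p₁ x q₁ := by
  have hg₁ := isPotential_voltage (Γ := Γ₁) p₁ q₁
  have hg₂ := isPotential_voltage (Γ := Γ₂) p₂ q₂
  obtain ⟨f, hf₁, hf₂⟩ := h.exists_extension (fun x => 1 * f₁ x + α * Γ₁.voltage p₁ x q₁)
    (fun x => -α * Γ₂.voltage p₂ x q₂ + f₁ p₁) (by simp)
    (by simp only [resistance] at hα; linarith)
  have hr : Γ.Regular f := by
    rw [h.regular_iff, hf₁, hf₂]
    exact ⟨hf.1.linear _ _ hg₁.1, (hg₂.1.const_mul _).add (Regular.const _)⟩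
  refine ⟨f, ⟨hr, fun k hk => ?_⟩, congrFun hf₁⟩
  obtain ⟨hk₁, hk₂⟩ := (h.regular_iff k).1 hk
  -- The currents `α` and `-α` contribute opposite multiples of `k q - k p`, leaving only the source
  -- `y` and the sink `z`.
  rw [h.energy_eq hk hr, hf₁, hf₂, energy_linear_right _ _ hk₁ hf.1 hg₁.1,
    energy_add_const_right, energy_const_mul_right, hf.2 _ hk₁, hg₁.2 _ hk₁, hg₂.2 _ hk₂]
  simp only [Function.comp_apply, h.map_p, h.map_q]
  ring

/-- The current divider rule: `α = -r₁ / (r₁ + r₂)` leaves the fraction `r₂ / (r₁ + r₂)` of the unit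
current in `Γ₁`. -/
theorem voltage_left (h : IsTwoPointUnion Γ Γ₁ Γ₂ i₁ i₂ p₁ q₁ p₂ q₂)
    (hR : Γ₁.resistance p₁ q₁ + Γ₂.resistance p₂ q₂ ≠ 0) (x : X₁) :
    Γ.voltage (i₁ p₁) (i₁ x) (i₁ q₁) = Γ₂.resistance p₂ q₂ /
      (Γ₁.resistance p₁ q₁ + Γ₂.resistance p₂ q₂) * Γ₁.voltage p₁ x q₁ := by
  obtain ⟨f, hf, h₁⟩ := h.exists_isPotential (isPotential_voltage p₁ q₁)
    (α := -Γ₁.resistance p₁ q₁ / (Γ₁.resistance p₁ q₁ + Γ₂.resistance p₂ q₂)) (by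
      rw [voltage_self, ← resistance]
      field_simp
      ring)
  rw [hf.voltage_eq, h₁, h₁, voltage_self]
  field_simp
  ring

theorem resistance_eq (h : IsTwoPointUnion Γ Γ₁ Γ₂ i₁ i₂ p₁ q₁ p₂ q₂)
    (hR : Γ₁.resistance p₁ q₁ + Γ₂.resistance p₂ q₂ ≠ 0) :
    Γ.resistance (i₁ p₁) (i₁ q₁) = Γ₁.resistance p₁ q₁ * Γ₂.resistance p₂ q₂ /
      (Γ₁.resistance p₁ q₁ + Γ₂.resistance p₂ q₂) := by
  rw [resistance, h.voltage_left hR, ← resistance]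
  ring

/-- By reciprocity, `j_x(·, q)` on `Γ₁` drops by `r₁ - j_p(x, q)` from `q` to `p`. This fixes the
circulating current `α`, and the correction is `-α * j_p(x, q)`. -/
theorem voltage_base_left (h : IsTwoPointUnion Γ Γ₁ Γ₂ i₁ i₂ p₁ q₁ p₂ q₂)
    (hR : Γ₁.resistance p₁ q₁ + Γ₂.resistance p₂ q₂ ≠ 0) (x : X₁) :
    Γ.voltage (i₁ x) (i₁ p₁) (i₁ q₁) = Γ₁.voltage x p₁ q₁ +
      1 / (Γ₁.resistance p₁ q₁ + Γ₂.resistance p₂ q₂) *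
        (Γ₁.voltage p₁ x q₁ * (Γ₁.resistance p₁ q₁ - Γ₁.voltage p₁ x q₁)) := by
  have hx := isPotential_voltage (Γ := Γ₁) x q₁
  have hrec : Γ₁.voltage x q₁ q₁ - Γ₁.voltage x p₁ q₁ =
      Γ₁.resistance p₁ q₁ - Γ₁.voltage p₁ x q₁ :=
    hx.reciprocity (isPotential_voltage (Γ := Γ₁) p₁ q₁)
  obtain ⟨f, hf, h₁⟩ := h.exists_isPotential hx
    (α := -(Γ₁.resistance p₁ q₁ - Γ₁.voltage p₁ x q₁) /
      (Γ₁.resistance p₁ q₁ + Γ₂.resistance p₂ q₂)) (by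
      rw [hrec]
      field_simp
      ring)
  rw [hf.voltage_eq, h₁, h₁, voltage_self, voltage_self]
  field_simp
  ring

theorem weightedEnergy_left (h : IsTwoPointUnion Γ Γ₁ Γ₂ i₁ i₂ p₁ q₁ p₂ q₂)
    (hR : Γ₁.resistance p₁ q₁ + Γ₂.resistance p₂ q₂ ≠ 0) :
    Γ₁.weightedEnergy ((fun x => Γ.voltage x (i₁ p₁) (i₁ q₁)) ∘ i₁)
        ((fun x => Γ.voltage (i₁ p₁) x (i₁ q₁)) ∘ i₁)
        ((fun x => Γ.voltage (i₁ p₁) x (i₁ q₁)) ∘ i₁) =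
      (Γ₂.resistance p₂ q₂ / (Γ₁.resistance p₁ q₁ + Γ₂.resistance p₂ q₂)) ^ 2 *
        (Γ₁.A p₁ q₁ + 1 / (Γ₁.resistance p₁ q₁ + Γ₂.resistance p₂ q₂) *
          (Γ₁.resistance p₁ q₁ ^ 3 / 6)) := by
  have hg := (isPotential_voltage (Γ := Γ₁) p₁ q₁).1
  have e₁ := funext (h.voltage_base_left hR)
  have e₂ := funext (h.voltage_left hR)
  have hw : Γ₁.EdgeContinuous fun x =>
      Γ₁.voltage p₁ x q₁ * (Γ₁.resistance p₁ q₁ - Γ₁.voltage p₁ x q₁) := by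
    simp only [sub_eq_add_neg, neg_eq_neg_one_mul (Γ₁.voltage p₁ _ q₁)]
    exact (hg.mul ((Regular.const _).add (hg.const_mul (-1)))).edgeContinuous
  simp only [Function.comp_def]
  rw [e₁, e₂, weightedEnergy_const_mul_left, weightedEnergy_const_mul_right,
    weightedEnergy_add_weight (edgeContinuous_voltage_base p₁ q₁)
      ((EdgeContinuous.const _).mul hw) hg hg, weightedEnergy_const_mul_weight,
    weightedEnergy_voltage, A_eq_weightedEnergy]
  ring

theorem A_eq (h : IsTwoPointUnion Γ Γ₁ Γ₂ i₁ i₂ p₁ q₁ p₂ q₂)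
    (hR : Γ₁.resistance p₁ q₁ + Γ₂.resistance p₂ q₂ ≠ 0) :
    Γ.A (i₁ p₁) (i₁ q₁) =
      ((Γ₂.resistance p₂ q₂) ^ 2 * Γ₁.A p₁ q₁ + (Γ₁.resistance p₁ q₁) ^ 2 * Γ₂.A p₂ q₂) /
          (Γ₁.resistance p₁ q₁ + Γ₂.resistance p₂ q₂) ^ 2 +
        1 / 6 * (Γ₁.resistance p₁ q₁ * Γ₂.resistance p₂ q₂ /
          (Γ₁.resistance p₁ q₁ + Γ₂.resistance p₂ q₂)) ^ 2 := by
  have hR' : Γ₂.resistance p₂ q₂ + Γ₁.resistance p₁ q₁ ≠ 0 := by rwa [add_comm]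
  have hg := (isPotential_voltage (Γ := Γ) (i₁ p₁) (i₁ q₁)).1
  have h₂ := h.symm.weightedEnergy_left hR'
  rw [← h.map_p, ← h.map_q] at h₂
  rw [A_eq_weightedEnergy, h.weightedEnergy_eq _ _ _ (edgeContinuous_voltage_base _ _) hg hg,
    h.weightedEnergy_left hR, h₂]
  rw [add_comm (Γ₂.resistance p₂ q₂)]
  -- The correction terms combine through `r₁³ r₂² + r₁² r₂³ = r₁² r₂² (r₁ + r₂)`.
  field_simp
  ring

end IsTwoPointUnion

theorem glue_isTwoPointUnion {X₁ X₂ E₁ E₂ : Type*} [Fintype E₁] [Fintype E₂]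
    (Γ₁ : MetrizedGraph X₁ E₁) (Γ₂ : MetrizedGraph X₂ E₂) (p₁ q₁ : X₁) (p₂ q₂ : X₂) :
    IsTwoPointUnion (Γ₁.glue Γ₂ p₁ q₁ p₂ q₂) Γ₁ Γ₂ (Glue.inl p₁ q₁ p₂ q₂)
      (Glue.inr p₁ q₁ p₂ q₂) p₁ q₁ p₂ q₂ where
  map_p := Quot.sound GlueRel.left
  map_q := Quot.sound GlueRel.right
  regular_iff f := ⟨fun h => ⟨fun e => h (Sum.inl e), fun e => h (Sum.inr e)⟩,
    fun h => by
      rintro (e | e)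
      · exact h.1 e
      · exact h.2 e⟩
  weightedEnergy_eq F k f _ _ _ := Fintype.sum_sum_type _
  exists_extension f₁ f₂ hp hq := by
    refine ⟨Quot.lift (Sum.elim f₁ f₂) ?_, rfl, rfl⟩
    rintro _ _ (_ | _)
    · exact hp
    · exact hq

/-! ### The segment -/

section segment

variable {L : Fin 1 → ℝ}

/-- The distance from `p` on a segment. -/
def _root_.BananaPoint.position {m : ℕ} {L : Fin m → ℝ} (l : ℝ) : BananaPoint L → ℝ
  | .p => 0
  | .q => l
  | .interior _ t _ => t

theorem _root_.BananaPoint.position_param (i : Fin 1) {t : ℝ}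
    (ht : t ∈ Icc 0 (L 0)) : (BananaPoint.param L i t).position (L 0) = t := by
  obtain rfl := Subsingleton.elim i 0
  rw [BananaPoint.param]
  split_ifs with h0 h1
  · exact le_antisymm ht.1 h0
  · exact le_antisymm h1 ht.2
  · rfl

theorem _root_.BananaPoint.param_position (hL : 0 < L 0) (x : BananaPoint L) :
    x.position (L 0) ∈ Icc 0 (L 0) ∧ BananaPoint.param L 0 (x.position (L 0)) = x := by
  rcases x with _ | _ | ⟨i, t, ht⟩
  · exact ⟨⟨le_rfl, hL.le⟩, by simp [BananaPoint.position, BananaPoint.param]⟩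
  · exact ⟨⟨hL.le, le_rfl⟩, by simp [BananaPoint.position, BananaPoint.param, hL]⟩
  · obtain rfl := Subsingleton.elim i 0
    exact ⟨Ioo_subset_Icc_self ht, BananaPoint.param_of_mem L 0 t ht⟩

/-- A single hinge at the position `s` of `x` is a potential: its energy against `h` is the integral
of `h'` from `s` to the end `q`. -/
theorem voltage_segment (hm : 1 ≤ 1) (hL : ∀ i, 0 < L i) (x y : BananaPoint L) :
    (bananaGraph 1 hm L hL).voltage x y .q =
      max (y.position (L 0) - x.position (L 0)) 0 := by
  obtain ⟨hx, hx'⟩ := BananaPoint.param_position (hL 0) x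
  set s := x.position (L 0) with hs
  have hpos : ∀ t ∈ Icc 0 (L 0),
      (fun t => max ((BananaPoint.param L 0 t).position (L 0) - s) 0) t =
        hinge {s} 0 (fun _ => 1) t := by
    intro t ht
    simp [hinge, BananaPoint.position_param 0 ht]
  have hpot : (bananaGraph 1 hm L hL).IsPotential .q x
      fun y => max (y.position (L 0) - s) 0 := by
    refine ⟨fun i => ?_, fun h hh => ?_⟩
    · obtain rfl := Subsingleton.elim i 0
      exact (regularOn_hinge {s} 0 (fun _ => 1) 0 (L 0)).congr hpos
    · have h1 := integral_deriv_mul_deriv_hinge (S := {s}) (by simpa using hx) 0 (fun _ => 1)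
        (hL 0).le (hh 0)
      have h2 : (bananaGraph 1 hm L hL).param 0 (L 0) = .q := by
        simp [bananaGraph, BananaPoint.param, hL 0]
      have h3 : (bananaGraph 1 hm L hL).param 0 s = x := hx'
      simp only [Finset.sum_singleton, one_mul, h3] at h1
      rw [show h (.q) = h ((bananaGraph 1 hm L hL).param 0 (L 0)) by rw [h2]]
      refine Eq.trans ?_ h1
      simp only [energy, weightedEnergy, Fin.sum_univ_one, one_mul]
      refine integral_congr_off_finite (hL 0).le finite_empty fun t ht => ?_
      congr 1
      refine Filter.EventuallyEq.deriv_eq ?_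
      filter_upwards [Icc_mem_nhds ht.1.1 ht.1.2] with r hr using hpos r hr
  rw [hpot.voltage_eq]
  simp [← hs]

theorem resistance_segment (hm : 1 ≤ 1) (hL : ∀ i, 0 < L i) :
    (bananaGraph 1 hm L hL).resistance .p .q = L 0 := by
  simp [resistance, voltage_segment, BananaPoint.position, (hL 0).le]

/-- Current entering at `q` and leaving at `x` never reaches the part between `p` and `x`, so the
weight `j_x(p, q)` is identically zero. -/
theorem A_segment (hm : 1 ≤ 1) (hL : ∀ i, 0 < L i) :
    (bananaGraph 1 hm L hL).A .p .q = 0 := by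
  have h : ∀ x, (bananaGraph 1 hm L hL).voltage x .p .q = 0 := fun x => by
    rw [voltage_segment]
    have := (BananaPoint.param_position (hL 0) x).1.1
    simpa [BananaPoint.position] using this
  simp [A, h]

end segment

/-- Functions on two pieces that agree at the common points extend to the union. -/
theorem exists_extension_of_injective {X X₁ X₂ : Type*} {i₁ : X₁ → X} {i₂ : X₂ → X} {p₁ q₁ : X₁}
    {p₂ q₂ : X₂} (h₁ : Function.Injective i₁) (h₂ : Function.Injective i₂)
    (h : ∀ x y, i₁ x = i₂ y → x = p₁ ∧ y = p₂ ∨ x = q₁ ∧ y = q₂) (f₁ : X₁ → ℝ) (f₂ : X₂ → ℝ)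
    (hp : f₁ p₁ = f₂ p₂) (hq : f₁ q₁ = f₂ q₂) :
    ∃ f : X → ℝ, f ∘ i₁ = f₁ ∧ f ∘ i₂ = f₂ := by
  refine ⟨Function.extend i₁ f₁ (Function.extend i₂ f₂ 0), ?_, ?_⟩
  · exact funext fun x => h₁.extend_apply _ _ _
  · funext y
    rw [Function.comp_apply]
    by_cases hy : ∃ x, i₁ x = i₂ y
    · obtain ⟨x, hx⟩ := hy
      rw [← hx, h₁.extend_apply]
      rcases h x y hx with ⟨rfl, rfl⟩ | ⟨rfl, rfl⟩
      · exact hp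
      · exact hq
    · rw [Function.extend_apply' _ _ _ hy, h₂.extend_apply]

/-! ### Banana graphs -/

section banana

variable {m n : ℕ} {L : Fin m → ℝ}

/-- The inclusion of the banana graph on some of the edges. -/
def _root_.BananaPoint.reindex (σ : Fin n → Fin m) : BananaPoint (L ∘ σ) → BananaPoint L
  | .p => .p
  | .q => .q
  | .interior i t ht => .interior (σ i) t ht

theorem _root_.BananaPoint.reindex_param (σ : Fin n → Fin m) (i : Fin n) (t : ℝ) :
    (BananaPoint.param (L ∘ σ) i t).reindex σ = BananaPoint.param L (σ i) t := by
  simp only [BananaPoint.param, Function.comp_apply]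
  split_ifs <;> rfl

theorem _root_.BananaPoint.reindex_injective {σ : Fin n → Fin m} (hσ : Function.Injective σ) :
    Function.Injective (BananaPoint.reindex (L := L) σ) := by
  rintro (_ | _ | ⟨i, t, ht⟩) (_ | _ | ⟨j, s, hs⟩) h <;>
    simp only [BananaPoint.reindex, BananaPoint.interior.injEq, reduceCtorEq] at h ⊢
  obtain ⟨hij, rfl⟩ := h
  exact ⟨hσ hij, rfl⟩

end banana

end MetrizedGraph

namespace MetrizedGraph

section banana

variable {m : ℕ} {L : Fin (m + 1) → ℝ}

theorem banana_isTwoPointUnion (hm : 1 ≤ m) (hm' : 1 ≤ m + 1) (hL : ∀ i, 0 < L i) :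
    IsTwoPointUnion (bananaGraph (m + 1) hm' L hL)
      (bananaGraph m hm (L ∘ Fin.castSucc) fun _ => hL _)
      (bananaGraph 1 le_rfl (L ∘ fun _ => Fin.last m) fun _ => hL _)
      (BananaPoint.reindex Fin.castSucc) (BananaPoint.reindex fun _ => Fin.last m)
      .p .q .p .q where
  map_p := rfl
  map_q := rfl
  regular_iff f := by
    simp only [Regular, bananaGraph, Function.comp_apply, BananaPoint.reindex_param]
    rw [Fin.forall_fin_succ', Fin.forall_fin_one]
  weightedEnergy_eq F k f _ _ _ := by
    simp only [weightedEnergy, bananaGraph, Function.comp_apply, BananaPoint.reindex_param]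
    rw [Fin.sum_univ_castSucc, Fin.sum_univ_one]
  exists_extension f₁ f₂ hp hq := by
    refine exists_extension_of_injective
      (BananaPoint.reindex_injective (Fin.castSucc_injective m))
      (BananaPoint.reindex_injective (Function.injective_of_subsingleton _)) ?_ f₁ f₂ hp hq
    rintro (_ | _ | ⟨i, t, ht⟩) (_ | _ | ⟨j, s, hs⟩) h <;>
      simp only [BananaPoint.reindex, BananaPoint.interior.injEq, reduceCtorEq] at h ⊢
    · simp
    · simp
    · exact absurd h.1 (Fin.castSucc_ne_last i)

/-- Splitting off the last edge, which has `A = 0`: with `R = r₁ r₂ / (r₁ + r₂)`, the union formula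
reads `(m - 1) R² / 6 + R² / 6`. -/
theorem A_banana (m : ℕ) (hm : 1 ≤ m) (L : Fin m → ℝ) (hL : ∀ i, 0 < L i) :
    (bananaGraph m hm L hL).A .p .q =
      ((m : ℝ) - 1) * (bananaGraph m hm L hL).resistance .p .q ^ 2 / 6 := by
  induction m, hm using Nat.le_induction with
  | base => rw [A_segment]; simp
  | succ m hm ih =>
    have h := banana_isTwoPointUnion hm (by omega) hL
    have h₁ : 0 < (bananaGraph m hm (L ∘ Fin.castSucc) fun _ => hL _).resistance .p .q :=
      resistance_pos (by simp)
    have h₂ : 0 < (bananaGraph 1 le_rfl (L ∘ fun _ => Fin.last m) fun _ => hL _).resistance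
      .p .q := resistance_pos (by simp)
    have hA := h.A_eq (by positivity)
    have hR := h.resistance_eq (by positivity)
    rw [ih, A_segment] at hA
    refine hA.trans ?_
    rw [show (BananaPoint.p : BananaPoint L) = BananaPoint.reindex Fin.castSucc .p from rfl,
      show (BananaPoint.q : BananaPoint L) = BananaPoint.reindex Fin.castSucc .q from rfl, hR]
    push_cast
    field_simp
    ring

end banana

/-! ### The circle -/

theorem _root_.RegularOn.of_periodic {u : ℝ → ℝ} {ℓ c : ℝ} (hℓ : 0 < ℓ)
    (hu : Function.Periodic u ℓ) (h : RegularOn u c (c + ℓ)) (d : ℝ) : RegularOn u d (d + ℓ) := by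
  have hshift : ∀ n : ℤ, RegularOn u (c + n * ℓ) (c + n * ℓ + ℓ) := by
    intro n
    have h1 : (fun t => u (-(n * ℓ) + t)) = u := by
      funext t
      rw [neg_add_eq_sub, ← zsmul_eq_mul]
      exact hu.sub_zsmul_eq n
    rw [← h1]
    apply RegularOn.comp_const_add
    convert h using 1 <;> ring
  -- The window `[d, d + ℓ]` lies in the union of the translates of `[c, c + ℓ]` by `n ℓ` and `(n +
  -- 1) ℓ`.
  set n := ⌊(d - c) / ℓ⌋ with hn
  have h1 : n * ℓ ≤ d - c := (le_div_iff₀ hℓ).1 (Int.floor_le _)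
  have h2 : d - c < (n + 1) * ℓ := (div_lt_iff₀ hℓ).1 (Int.lt_floor_add_one _)
  have h3 := hshift (n + 1)
  push_cast at h3
  rw [show c + (n + 1) * ℓ = c + n * ℓ + ℓ by ring] at h3
  exact ((hshift n).trans h3 (by linarith) (by linarith)).mono (by linarith) (by linarith)

section circle

variable {a b : ℝ}

theorem periodic_coe (f : AddCircle (a + b) → ℝ) :
    Function.Periodic (fun t : ℝ => f (t : AddCircle (a + b))) (a + b) := fun t => by
  simp only [AddCircle.coe_add_period]

theorem circle_regular_iff (hab : 0 < a + b) (f : AddCircle (a + b) → ℝ) (c : ℝ) :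
    (circleGraph (a + b) hab).Regular f ↔
      RegularOn (fun t : ℝ => f (t : AddCircle (a + b))) c (c + (a + b)) := by
  constructor
  · intro h
    refine RegularOn.of_periodic (c := 0) hab (periodic_coe f) ?_ c
    rw [zero_add]
    exact h ()
  · intro h e
    have := RegularOn.of_periodic hab (periodic_coe f) h 0
    rwa [zero_add] at this

/-- By periodicity the integral may be taken over `[s - b, s + a]`, which is cut at `s` into the two
arcs. -/
theorem circle_weightedEnergy (ha : 0 < a) (hb : 0 < b) {F k f : AddCircle (a + b) → ℝ}
    (hF : (circleGraph (a + b) (add_pos ha hb)).EdgeContinuous F)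
    (hk : (circleGraph (a + b) (add_pos ha hb)).Regular k)
    (hf : (circleGraph (a + b) (add_pos ha hb)).Regular f) (s : ℝ) :
    (circleGraph (a + b) (add_pos ha hb)).weightedEnergy F k f =
      (∫ t in s..s + a, F (t : AddCircle (a + b)) *
        (deriv (fun r : ℝ => k (r : AddCircle (a + b))) t *
          deriv (fun r : ℝ => f (r : AddCircle (a + b))) t)) +
      ∫ t in (s - b)..s, F (t : AddCircle (a + b)) *
        (deriv (fun r : ℝ => k (r : AddCircle (a + b))) t *
          deriv (fun r : ℝ => f (r : AddCircle (a + b))) t) := by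
  have hab := add_pos ha hb
  set G : ℝ → ℝ := fun t => F (t : AddCircle (a + b)) *
        (deriv (fun r : ℝ => k (r : AddCircle (a + b))) t *
          deriv (fun r : ℝ => f (r : AddCircle (a + b))) t) with hG
  have hd : ∀ g : AddCircle (a + b) → ℝ,
      Function.Periodic (deriv fun r : ℝ => g (r : AddCircle (a + b))) (a + b) := fun g t => by
    rw [← deriv_comp_add_const]
    exact congrArg (fun v => deriv v t) (funext (periodic_coe g))
  have hper : Function.Periodic G (a + b) := (periodic_coe F).mul ((hd k).mul (hd f))
  have hint : IntervalIntegrable G volume 0 (a + b) :=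
    RegularOn.intervalIntegrable_weighted (hF ()) (hk ()) (hf ()) hab.le
  have hint' := hper.intervalIntegrable₀ hab.ne' hint
  have h1 : (circleGraph (a + b) (add_pos ha hb)).weightedEnergy F k f =
      ∫ t in (0 : ℝ)..a + b, G t := by
    simp only [weightedEnergy, circleGraph, Finset.univ_unique, Finset.sum_singleton, hG]
  rw [h1, add_comm (∫ t in s..s + a, G t),
    intervalIntegral.integral_add_adjacent_intervals (hint' _ _) (hint' _ _)]
  have := hper.intervalIntegral_add_eq 0 (s - b)
  rwa [zero_add, show s - b + (a + b) = s + a by ring] at this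

theorem coe_eq_coe_imp (hab : 0 < a + b) {t r : ℝ}
    (h : (t : AddCircle (a + b)) = (r : AddCircle (a + b))) (h1 : t - r < a + b)
    (h2 : 0 ≤ t - r) : t = r := by
  rw [← sub_eq_zero, ← AddCircle.coe_sub, AddCircle.coe_eq_zero_iff] at h
  obtain ⟨n, hn⟩ := h
  rw [zsmul_eq_mul] at hn
  have hn1 : (n : ℝ) < 1 := by nlinarith
  have hn0 : (-1 : ℝ) < n := by nlinarith
  have : n = 0 := by
    have h3 : n < 1 := by exact_mod_cast hn1
    have h4 : -1 < n := by exact_mod_cast hn0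
    omega
  rw [this, Int.cast_zero, zero_mul] at hn
  linarith

/-- From the base point `s` one arc runs forward through length `a`, the other backward through
length `b`; they meet again because `s + a` and `s - b` differ by a period. -/
theorem circle_isTwoPointUnion (ha : 0 < a) (hb : 0 < b) (s : ℝ) :
    IsTwoPointUnion (circleGraph (a + b) (add_pos ha hb))
      (bananaGraph 1 le_rfl (fun _ => a) fun _ => ha)
      (bananaGraph 1 le_rfl (fun _ => b) fun _ => hb)
      (fun x => ((s + x.position a : ℝ) : AddCircle (a + b)))
      (fun x => ((s - x.position b : ℝ) : AddCircle (a + b))) .p .q .p .q := by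
  have hab := add_pos ha hb
  have hp₁ : ∀ t ∈ Icc 0 a,
      (BananaPoint.param (fun _ : Fin 1 => a) 0 t).position a = t :=
    fun t ht => BananaPoint.position_param (L := fun _ : Fin 1 => a) 0 ht
  have hp₂ : ∀ t ∈ Icc 0 b,
      (BananaPoint.param (fun _ : Fin 1 => b) 0 t).position b = t :=
    fun t ht => BananaPoint.position_param (L := fun _ : Fin 1 => b) 0 ht
  have hb₁ : ∀ x : BananaPoint (fun _ : Fin 1 => a), x.position a ∈ Icc 0 a ∧
      BananaPoint.param (fun _ : Fin 1 => a) 0 (x.position a) = x :=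
    BananaPoint.param_position (L := fun _ : Fin 1 => a) ha
  have hb₂ : ∀ x : BananaPoint (fun _ : Fin 1 => b), x.position b ∈ Icc 0 b ∧
      BananaPoint.param (fun _ : Fin 1 => b) 0 (x.position b) = x :=
    BananaPoint.param_position (L := fun _ : Fin 1 => b) hb
  have hinj₁ : Function.Injective (BananaPoint.position (L := fun _ : Fin 1 => a) a) :=
    fun x y h => by rw [← (hb₁ x).2, ← (hb₁ y).2, h]
  have hinj₂ : Function.Injective (BananaPoint.position (L := fun _ : Fin 1 => b) b) :=
    fun x y h => by rw [← (hb₂ x).2, ← (hb₂ y).2, h]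
  refine ⟨?_, ?_, fun f => ?_, fun F k f hF hk hf => ?_, ?_⟩
  · simp [BananaPoint.position]
  · have := AddCircle.coe_add_period (a + b) (s - b)
    rw [show s - b + (a + b) = s + a by ring] at this
    exact this
  · have h₁ : (bananaGraph 1 le_rfl (fun _ => a) fun _ => ha).Regular
        (f ∘ fun x => ((s + x.position a : ℝ) : AddCircle (a + b))) ↔
        RegularOn (fun t : ℝ => f ((s + t : ℝ) : AddCircle (a + b))) 0 a := by
      have he : EqOn (fun t : ℝ => f ((s + t : ℝ) : AddCircle (a + b)))
        (fun t => (f ∘ fun x : BananaPoint (fun _ : Fin 1 => a) =>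
          ((s + x.position a : ℝ) : AddCircle (a + b)))
          (BananaPoint.param (fun _ : Fin 1 => a) 0 t)) (Icc 0 a) := fun t ht => by
        simp only [Function.comp_apply, hp₁ t ht]
      refine ⟨fun h => (h 0).congr he, fun h e => ?_⟩
      obtain rfl := Subsingleton.elim e 0
      exact h.congr he.symm
    have h₂ : (bananaGraph 1 le_rfl (fun _ => b) fun _ => hb).Regular
        (f ∘ fun x => ((s - x.position b : ℝ) : AddCircle (a + b))) ↔
        RegularOn (fun t : ℝ => f ((s - t : ℝ) : AddCircle (a + b))) 0 b := by
      have he : EqOn (fun t : ℝ => f ((s - t : ℝ) : AddCircle (a + b)))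
        (fun t => (f ∘ fun x : BananaPoint (fun _ : Fin 1 => b) =>
          ((s - x.position b : ℝ) : AddCircle (a + b)))
          (BananaPoint.param (fun _ : Fin 1 => b) 0 t)) (Icc 0 b) := fun t ht => by
        simp only [Function.comp_apply, hp₂ t ht]
      refine ⟨fun h => (h 0).congr he, fun h e => ?_⟩
      obtain rfl := Subsingleton.elim e 0
      exact h.congr he.symm
    rw [h₁, h₂, circle_regular_iff hab f (s - b), show s - b + (a + b) = s + a by ring]
    constructor
    · intro h
      constructor
      · refine RegularOn.comp_const_add (u := fun t : ℝ => f (t : AddCircle (a + b))) s ?_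
        exact h.mono (by linarith) le_rfl
      · refine RegularOn.comp_const_sub (u := fun t : ℝ => f (t : AddCircle (a + b))) s ?_
        exact h.mono le_rfl (by linarith)
    · rintro ⟨k₁, k₂⟩
      have k₃ : RegularOn (fun t : ℝ => f (t : AddCircle (a + b))) s (s + a) := by
        have := RegularOn.comp_const_add (a := s) (b := s + a) (-s)
          (u := fun t : ℝ => f ((s + t : ℝ) : AddCircle (a + b))) (by simpa using k₁)
        simpa using this
      have k₄ : RegularOn (fun t : ℝ => f (t : AddCircle (a + b))) (s - b) s := by
        have := RegularOn.comp_const_sub (a := s - b) (b := s) s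
          (u := fun t : ℝ => f ((s - t : ℝ) : AddCircle (a + b))) (by simpa using k₂)
        simpa using this
      exact k₄.trans k₃ (by linarith) (by linarith)
  · rw [circle_weightedEnergy ha hb hF hk hf s]
    have hd₁ : ∀ g : AddCircle (a + b) → ℝ, ∀ t ∈ Ioo 0 a,
        deriv (fun r => (g ∘ fun x : BananaPoint (fun _ : Fin 1 => a) =>
          ((s + x.position a : ℝ) : AddCircle (a + b)))
          (BananaPoint.param (fun _ : Fin 1 => a) 0 r)) t =
        deriv (fun r : ℝ => g (r : AddCircle (a + b))) (s + t) := by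
      intro g t ht
      rw [← deriv_comp_const_add]
      refine Filter.EventuallyEq.deriv_eq ?_
      filter_upwards [Icc_mem_nhds ht.1 ht.2] with r hr
      simp only [Function.comp_apply, hp₁ r hr]
    have hd₂ : ∀ g : AddCircle (a + b) → ℝ, ∀ t ∈ Ioo 0 b,
        deriv (fun r => (g ∘ fun x : BananaPoint (fun _ : Fin 1 => b) =>
          ((s - x.position b : ℝ) : AddCircle (a + b)))
          (BananaPoint.param (fun _ : Fin 1 => b) 0 r)) t =
        -deriv (fun r : ℝ => g (r : AddCircle (a + b))) (s - t) := by
      intro g t ht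
      rw [← deriv_comp_const_sub]
      refine Filter.EventuallyEq.deriv_eq ?_
      filter_upwards [Icc_mem_nhds ht.1 ht.2] with r hr
      simp only [Function.comp_apply, hp₂ r hr]
    set G : ℝ → ℝ := fun t => F (t : AddCircle (a + b)) *
        (deriv (fun r : ℝ => k (r : AddCircle (a + b))) t *
          deriv (fun r : ℝ => f (r : AddCircle (a + b))) t) with hG
    have e₁ := intervalIntegral.integral_comp_add_left (a := 0) (b := a) G s
    have e₂ := intervalIntegral.integral_comp_sub_left (a := 0) (b := b) G s
    rw [add_zero] at e₁
    rw [sub_zero] at e₂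
    rw [← e₁, ← e₂]
    simp only [weightedEnergy, Fin.sum_univ_one]
    congr 1
    · refine integral_congr_off_finite ha.le finite_empty fun t ht => ?_
      have h1 := hd₁ k t ht.1
      have h2 := hd₁ f t ht.1
      simp only [bananaGraph] at h1 h2 ⊢
      rw [h1, h2, Function.comp_apply, hp₁ t (Ioo_subset_Icc_self ht.1)]
    · refine integral_congr_off_finite hb.le finite_empty fun t ht => ?_
      have h1 := hd₂ k t ht.1
      have h2 := hd₂ f t ht.1
      simp only [bananaGraph] at h1 h2 ⊢
      -- Reversing the orientation changes the sign of both derivatives and so preserves their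
      -- product.
      rw [h1, h2, Function.comp_apply, hp₂ t (Ioo_subset_Icc_self ht.1), neg_mul_neg]
  · refine exists_extension_of_injective ?_ ?_ ?_
    · intro x y h
      have hx := (hb₁ x).1
      have hy := (hb₁ y).1
      apply hinj₁
      rcases le_total (x.position a) (y.position a) with hle | hle
      · have := coe_eq_coe_imp hab h.symm (by linarith [hx.1, hy.2]) (by linarith)
        linarith
      · have := coe_eq_coe_imp hab h (by linarith [hy.1, hx.2]) (by linarith)
        linarith
    · intro x y h
      have hx := (hb₂ x).1
      have hy := (hb₂ y).1
      apply hinj₂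
      rcases le_total (x.position b) (y.position b) with hle | hle
      · have := coe_eq_coe_imp hab h (by linarith [hx.1, hy.2]) (by linarith)
        linarith
      · have := coe_eq_coe_imp hab h.symm (by linarith [hy.1, hx.2]) (by linarith)
        linarith
    · intro x y h
      have hx := (hb₁ x).1
      have hy := (hb₂ y).1
      -- The lifts differ by the sum of the two positions, which lies in `[0, a + b]`. If it is
      -- below a full period both positions are `0`; otherwise both are maximal.
      rcases (add_le_add hx.2 hy.2).lt_or_eq with hlt | heq
      · have := coe_eq_coe_imp hab h (by linarith) (by linarith [hx.1, hy.1])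
        left
        constructor
        · apply hinj₁
          change x.position a = 0
          linarith [hx.1, hy.1]
        · apply hinj₂
          change y.position b = 0
          linarith [hx.1, hy.1]
      · right
        constructor
        · apply hinj₁
          change x.position a = a
          linarith [hx.2, hy.2]
        · apply hinj₂
          change y.position b = b
          linarith [hx.2, hy.2]

theorem A_circle (ha : 0 < a) (hb : 0 < b) (p : AddCircle (a + b)) :
    (circleGraph (a + b) (add_pos ha hb)).A p (p + (a : AddCircle (a + b))) =
      a ^ 2 * b ^ 2 / (6 * (a + b) ^ 2) := by
  obtain ⟨s, rfl⟩ := QuotientAddGroup.mk_surjective p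
  have hab := add_pos ha hb
  have h := (circle_isTwoPointUnion ha hb s).A_eq (by
    simp only [resistance_segment]
    exact hab.ne')
  simp only [resistance_segment, A_segment, BananaPoint.position, add_zero,
    AddCircle.coe_add] at h
  refine h.trans ?_
  field_simp
  ring

end circle

end MetrizedGraph

end

theorem mainTheorem10 :
    (∀ (X₁ X₂ E₁ E₂ : Type*) [Fintype E₁] [Fintype E₂]
      (Γ₁ : MetrizedGraph X₁ E₁) (Γ₂ : MetrizedGraph X₂ E₂)
      (p₁ q₁ : X₁) (p₂ q₂ : X₂), p₁ ≠ q₁ → p₂ ≠ q₂ →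
      (Γ₁.glue Γ₂ p₁ q₁ p₂ q₂).A (Glue.inl p₁ q₁ p₂ q₂ p₁) (Glue.inl p₁ q₁ p₂ q₂ q₁) =
        ((Γ₂.resistance p₂ q₂) ^ 2 * Γ₁.A p₁ q₁ + (Γ₁.resistance p₁ q₁) ^ 2 * Γ₂.A p₂ q₂) /
            (Γ₁.resistance p₁ q₁ + Γ₂.resistance p₂ q₂) ^ 2 +
          1 / 6 * (Γ₁.resistance p₁ q₁ * Γ₂.resistance p₂ q₂ /
            (Γ₁.resistance p₁ q₁ + Γ₂.resistance p₂ q₂)) ^ 2) ∧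
    (∀ (a b : ℝ) (ha : 0 < a) (hb : 0 < b) (p : AddCircle (a + b)),
      (circleGraph (a + b) (add_pos ha hb)).A p (p + (a : AddCircle (a + b))) =
        a ^ 2 * b ^ 2 / (6 * (a + b) ^ 2)) ∧
    (∀ (m : ℕ) (hm : 1 ≤ m) (L : Fin m → ℝ) (hL : ∀ i, 0 < L i),
      (bananaGraph m hm L hL).A BananaPoint.p BananaPoint.q =
        ((m : ℝ) - 1) * (bananaGraph m hm L hL).resistance BananaPoint.p BananaPoint.q ^ 2 / 6) := by
  refine ⟨fun X₁ X₂ E₁ E₂ _ _ Γ₁ Γ₂ p₁ q₁ p₂ q₂ h₁ h₂ => ?_,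
    fun a b ha hb p => MetrizedGraph.A_circle ha hb p, MetrizedGraph.A_banana⟩
  have hr₁ := MetrizedGraph.resistance_pos (Γ := Γ₁) h₁
  have hr₂ := MetrizedGraph.resistance_pos (Γ := Γ₂) h₂
  exact (MetrizedGraph.glue_isTwoPointUnion Γ₁ Γ₂ p₁ q₁ p₂ q₂).A_eq (by positivity)
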